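/- Let $D$ be an integral domain with quotient field $K$ and let $t$ be an indeterminate over $K$. An overring of $D$ is a ring $B$ with $D\subseteq B\subseteq K$; write $\overline{B}$ for its integral closure in $K$ and $B(t)=\{f/g : f,g\in B[t],\ c(g)=B\}\subseteq K(t)$ for its Nagata ring, where $c(g)$ is the ideal of $B$ generated by the coefficients of $g$. If $V$ is a valuation overring of $D$ (the case $V=K$ is allowed), then $V(t)$ is a valuation ring of $K(t)$. Let $\mathrm{Kr}(\overline{D})=\bigcap_V V(t)$, where $V$ runs through all valuation overrings of $\overline{D}$. For a valuation ring $V$, $\mathfrak m_V$ denotes its maximal ideal. **Theorem 5.15.** Let $A$ be a semilocal overring of $D$ (that is, with finitely many maximal ideals) such that $D=\overline{D}\cap A$. Suppose that $\overline{A}$ is semilocal with $s$ maximal ideals and that the residue field of $D$ at every maximal ideal has at least $s+1$ elements. Let $R'=\mathrm{Kr}(\overline{D})\cap A(t)$. Then the following hold. 1. For every valuation overring $V$ of $D$, putting $\mathfrak p=\mathfrak m_{V(t)}\cap R'$, we have $R'_{\mathfrak p}=\big((A\cap V)_{\mathfrak m_V\cap A}\big)(t)$. Moreover, if the only overring of $D$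 containing both $A$ and $V$ is $K$, then $R'_{\mathfrak p}=V(t)$. 2. For every valuation ring $\mathcal V$ of $K(t)$ with $R'\subseteq\mathcal V$ there is a valuation overring $V$ of $D$ such that $(A\cap V)(t)\subseteq\mathcal V$. 3. For every maximal ideal $\mathfrak M$ of $R'$ there is an overring $C$ of $D$ such that $R'_{\mathfrak M}=C(t)$. 4. The integral closure of $R'$ in $K(t)$, which is its quotient field, is $\mathrm{Kr}(\overline{D})\cap\overline{A}(t)$. -/

import Mathlib

open Polynomial

namespace NagataKronecker

section Nagata

variable {K : Type*} [Field K]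

/-- A polynomial with coefficients in the subring `B` of `K`, seen as an element of `K(t)`. -/
noncomputable def polyHom (B : Subring K) : B[X] →+* RatFunc K :=
  (algebraMap K[X] (RatFunc K)).comp (Polynomial.mapRingHom B.subtype)

theorem polyHom_ne_zero {B : Subring K} {g : B[X]} (hg : g.contentIdeal = ⊤) :
    polyHom B g ≠ 0 := by
  intro h
  have hinj : Function.Injective (polyHom B) :=
    (RatFunc.algebraMap_injective K).comp
      (Polynomial.map_injective B.subtype Subtype.val_injective)
  have h0 : g = 0 := hinj (by rw [h, map_zero])
  rw [h0, contentIdeal_zero] at hg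
  exact bot_ne_top hg

/-- The Nagata ring `B(t) = {f / g : f, g ∈ B[t], c(g) = B}` of a subring `B` of `K`, as a subring
of the field `K(t)`; here `c(g)` is the ideal of `B` generated by the coefficients of `g`. -/
noncomputable def nagata (B : Subring K) : Subring (RatFunc K) where
  carrier := {φ | ∃ f g : B[X], g.contentIdeal = ⊤ ∧ φ = polyHom B f / polyHom B g}
  mul_mem' := by
    rintro _ _ ⟨f, g, hg, rfl⟩ ⟨f', g', hg', rfl⟩
    refine ⟨f * f', g * g', contentIdeal_mul_eq_top_of_contentIdeal_eq_top hg hg', ?_⟩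
    rw [map_mul, map_mul, div_mul_div_comm]
  one_mem' := ⟨1, 1, contentIdeal_one, by simp⟩
  add_mem' := by
    rintro _ _ ⟨f, g, hg, rfl⟩ ⟨f', g', hg', rfl⟩
    refine ⟨f * g' + g * f', g * g', contentIdeal_mul_eq_top_of_contentIdeal_eq_top hg hg', ?_⟩
    rw [div_add_div _ _ (polyHom_ne_zero hg) (polyHom_ne_zero hg')]
    simp only [map_add, map_mul]
  zero_mem' := ⟨0, 1, contentIdeal_one, by simp⟩
  neg_mem' := by
    rintro _ ⟨f, g, hg, rfl⟩
    exact ⟨-f, g, hg, by rw [map_neg, neg_div]⟩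

/-- A polynomial with coefficients in `B` one of which is `1` has content `B`. -/
theorem contentIdeal_eq_top_of_coeff {B : Subring K} {g : B[X]} {n : ℕ} (h : g.coeff n = 1) :
    g.contentIdeal = ⊤ :=
  (Ideal.eq_top_iff_one _).2 (h ▸ coeff_mem_contentIdeal g n)

theorem exists_lift (V : ValuationSubring K) (p : K[X]) (h : ∀ n, p.coeff n ∈ V) :
    ∃ f : V.toSubring[X], f.map V.toSubring.subtype = p := by
  have : p ∈ Polynomial.lifts V.toSubring.subtype := by
    rw [Polynomial.lifts_iff_coeff_lifts]
    intro n
    exact ⟨⟨p.coeff n, h n⟩, rfl⟩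
  exact (Polynomial.mem_lifts _).1 this

/-- Either `V(t)` contains `φ` or it contains `φ⁻¹`. -/
theorem nagata_mem_or_inv_mem (V : ValuationSubring K) (φ : RatFunc K) :
    φ ∈ nagata V.toSubring ∨ φ⁻¹ ∈ nagata V.toSubring := by
  classical
  -- a nonzero polynomial divided by a coefficient of maximal size
  have key : ∀ p : K[X], p ≠ 0 → ∃ n, p.coeff n ≠ 0 ∧
      ∀ m, V.valuation (p.coeff m) ≤ V.valuation (p.coeff n) := by
    intro p hp
    obtain ⟨n, hn, hmax⟩ := p.support.exists_max_image (fun n => V.valuation (p.coeff n))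
      (Polynomial.support_nonempty.2 hp)
    refine ⟨n, Polynomial.mem_support_iff.1 hn, fun m => ?_⟩
    by_cases hm : p.coeff m = 0
    · rw [hm, map_zero]; exact zero_le
    · exact hmax m (Polynomial.mem_support_iff.2 hm)
  have main : ∀ p q : K[X], ∀ n, q.coeff n ≠ 0 →
      (∀ m, V.valuation (q.coeff m) ≤ V.valuation (q.coeff n)) →
      (∀ m, V.valuation (p.coeff m) ≤ V.valuation (q.coeff n)) →
      algebraMap K[X] (RatFunc K) p / algebraMap K[X] (RatFunc K) q ∈ nagata V.toSubring := by
    intro p q n hn hq hp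
    set c := q.coeff n with hc
    have hvc : V.valuation c ≠ 0 := (Valuation.ne_zero_iff _).2 hn
    have hmem : ∀ r : K[X], (∀ m, V.valuation (r.coeff m) ≤ V.valuation c) →
        ∀ m, (Polynomial.C c⁻¹ * r).coeff m ∈ V := by
      intro r hr m
      rw [← V.valuation_le_one_iff, Polynomial.coeff_C_mul, map_mul, map_inv₀, mul_comm,
        ← div_eq_mul_inv]
      exact div_le_one_of_le₀ (hr m) zero_le
    obtain ⟨f, hf⟩ := exists_lift V _ (hmem p hp)
    obtain ⟨g, hg⟩ := exists_lift V _ (hmem q hq)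
    refine ⟨f, g, contentIdeal_eq_top_of_coeff (n := n) ?_, ?_⟩
    · apply Subtype.ext
      have := congrArg (fun r => Polynomial.coeff r n) hg
      simp only [Polynomial.coeff_map, Polynomial.coeff_C_mul] at this
      rw [← hc, inv_mul_cancel₀ hn] at this
      exact this
    · have hC : algebraMap K[X] (RatFunc K) (Polynomial.C c⁻¹) ≠ 0 := by
        simpa using hn
      simp only [polyHom, RingHom.comp_apply, Polynomial.coe_mapRingHom, hf, hg, map_mul]
      rw [mul_div_mul_left _ _ hC]
  by_cases h0 : φ = 0
  · exact Or.inl (h0 ▸ (nagata V.toSubring).zero_mem)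
  obtain ⟨p, q, hq0, rfl⟩ := IsFractionRing.div_surjective (A := K[X]) φ
  have hq0 : q ≠ 0 := nonZeroDivisors.ne_zero hq0
  have hp0 : p ≠ 0 := by rintro rfl; simp at h0
  obtain ⟨n, hn, hnmax⟩ := key p hp0
  obtain ⟨m, hm, hmmax⟩ := key q hq0
  rcases le_total (V.valuation (p.coeff n)) (V.valuation (q.coeff m)) with h | h
  · exact Or.inl (main p q m hm hmmax fun k => (hnmax k).trans h)
  · right
    rw [inv_div]
    exact main q p n hn hnmax fun k => (hmmax k).trans h

/-- The trivial extension `V(t)` of a valuation ring `V` of `K`, as a valuation ring of `K(t)`: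
its elements are those of the Nagata ring of `V`. -/
noncomputable def trivialExtension (V : ValuationSubring K) : ValuationSubring (RatFunc K) :=
  { nagata V.toSubring with mem_or_inv_mem' := nagata_mem_or_inv_mem V }

/-- The Kronecker function ring `Kr(B)`: the intersection of the Nagata rings `V(t)`, where `V` runs
through the valuation rings of `K` that contain `B`. -/
noncomputable def kronecker (B : Subring K) : Subring (RatFunc K) :=
  ⨅ (V : ValuationSubring K) (_ : B ≤ V.toSubring), nagata V.toSubring

end Nagata

section Field

variable {L : Type*} [Field L]

/-- The integral closure of the subring `B` in the field `L`. -/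
def intClosure (B : Subring L) : Subring L := (integralClosure B L).toSubring

/-- The center `𝔪_V ∩ B` on `B` of a valuation ring `V` containing `B`. -/
def center (V : ValuationSubring L) (B : Subring L) (h : B ≤ V.toSubring) : Ideal B :=
  (IsLocalRing.maximalIdeal V).comap (Subring.inclusion h)

instance center_isPrime (V : ValuationSubring L) (B : Subring L) (h : B ≤ V.toSubring) :
    (center V B h).IsPrime :=
  Ideal.comap_isPrime _ _

/-- The localization `B_P` of the subring `B` at the prime ideal `P`, as a subring of `L`. -/
noncomputable def localizationAt (B : Subring L) (P : Ideal B) [P.IsPrime] : Subring L :=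
  (LocalSubring.ofPrime B P).toSubring

/-- A valuation ring containing `B` contains the integral closure of `B`. -/
theorem intClosure_le {B : Subring L} {V : ValuationSubring L} (h : B ≤ V.toSubring) :
    intClosure B ≤ V.toSubring := by
  rintro x ⟨p, hp, hx⟩
  have hxV : IsIntegral V x := by
    refine ⟨p.map (Subring.inclusion h), hp.map _, ?_⟩
    rw [Polynomial.eval₂_map]
    exact hx
  obtain ⟨y, rfl⟩ := (IsIntegrallyClosed.isIntegral_iff (R := V) (K := L)).1 hxV
  exact y.2

end Field

section Construction

variable {K : Type*} [Field K]

/-- The ring `R' = Kr(D̄) ∩ A(t)`, where `D̄` is the integral closure of `D` in `K`. -/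
noncomputable def krNagata (D A : Subring K) : Subring (RatFunc K) :=
  kronecker (intClosure D) ⊓ nagata A

/-- `R'` is contained in `V(t)` for every valuation ring `V` of `K` that contains `D`. -/
theorem krNagata_le {D : Subring K} (A : Subring K) {V : ValuationSubring K}
    (h : D ≤ V.toSubring) : krNagata D A ≤ (trivialExtension V).toSubring :=
  inf_le_left.trans (iInf₂_le V (intClosure_le h))

end Construction

end NagataKronecker

/-! For a valuation ring `V`, Gauss's lemma says that `f / g` lies in `V(t)` exactly when the Gauss
norm of `f` is at most that of `g`. So `f / g` with `f`, `g` over `A` and `g` of unit content lies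
in `R'` as soon as this inequality holds for every `V ⊇ D`. Three ideas give the theorem.

Unit combinations. Take `V` together with one valuation ring centered on each of the `s` maximal
ideals of the integral closure of `A`. Residue fields with at least `s + 1` elements allow a
`D`-linear combination `y` of the coefficients of `g` that attains the Gauss norm at all `s + 1` of
them (`exists_combination_unit`). Then `y` is a unit of `A`, and dividing `f` and `g` by `y` shows
`R' ⊆ (A ∩ V)(t)`. Conversely `R'` contains `1 / (1 + x t)` and `x / (1 + x t)` for `x ∈ A`, which
is enough to recover the Nagata ring after localizing (`localizationAt_eq_nagata`).

Compactness. If a valuation ring `W ⊇ R'` contained no `(A ∩ V)(t)`, each `V` would supply a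
fraction outside `W`. An ultrafilter limit reduces these to finitely many, and a sum with a large
power of `t` merges them into one fraction that lies in `R'` but not in `W`
(`exists_nagata_inf_le`). Statement 3 follows by applying this to a `W` centered on the given
maximal ideal.

Norms. A polynomial of unit content over the integral closure of `A` divides one of unit content
over `A`, by taking norms as resultants. Hence every `W ⊇ R'` gives such polynomials their Gauss
value (`gauss_le_valuation`), so it contains `Kr(D̄) ∩ Ā(t)`; the other inclusion is integrality in
`A(t)` and in each `V(t)`. -/

namespace NagataKronecker

/-! ### Gauss norms of polynomials. -/

section Gauss

variable {K : Type*} [Field K] {Γ : Type*} [LinearOrderedCommGroupWithZero Γ]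

/-- The Gauss norm of a polynomial: the largest value of a coefficient. -/
noncomputable def gauss (v : Valuation K Γ) (f : K[X]) : Γ :=
  f.support.sup fun n => v (f.coeff n)

theorem le_gauss (v : Valuation K Γ) (f : K[X]) (n : ℕ) : v (f.coeff n) ≤ gauss v f := by
  by_cases hn : n ∈ f.support
  · exact Finset.le_sup (f := fun n => v (f.coeff n)) hn
  · rw [notMem_support_iff.1 hn, map_zero]
    exact zero_le

theorem gauss_le_iff {v : Valuation K Γ} {f : K[X]} {c : Γ} :
    gauss v f ≤ c ↔ ∀ n, v (f.coeff n) ≤ c :=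
  ⟨fun h n => (le_gauss v f n).trans h, fun h => Finset.sup_le fun n _ => h n⟩

theorem gauss_lt_iff {v : Valuation K Γ} {f : K[X]} {c : Γ} (hc : 0 < c) :
    gauss v f < c ↔ ∀ n, v (f.coeff n) < c :=
  ⟨fun h n => (le_gauss v f n).trans_lt h, fun h =>
    (Finset.sup_lt_iff (by rwa [bot_eq_zero])).2 fun n _ => h n⟩

theorem exists_gauss_eq (v : Valuation K Γ) {f : K[X]} (hf : f ≠ 0) :
    ∃ n, f.coeff n ≠ 0 ∧ v (f.coeff n) = gauss v f := by
  obtain ⟨n, hn, h⟩ := Finset.exists_mem_eq_sup f.support (support_nonempty.2 hf)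
    (fun n => v (f.coeff n))
  exact ⟨n, mem_support_iff.1 hn, h.symm⟩

theorem gauss_pos (v : Valuation K Γ) {f : K[X]} (hf : f ≠ 0) : 0 < gauss v f := by
  obtain ⟨n, hn, h⟩ := exists_gauss_eq v hf
  rw [← h]
  exact zero_lt_iff.2 ((v.ne_zero_iff).2 hn)

@[simp]
theorem gauss_zero (v : Valuation K Γ) : gauss v (0 : K[X]) = 0 := by
  simp [gauss, bot_eq_zero]

theorem gauss_add_le (v : Valuation K Γ) (f g : K[X]) :
    gauss v (f + g) ≤ max (gauss v f) (gauss v g) := by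
  refine gauss_le_iff.2 fun n => ?_
  rw [coeff_add]
  exact (v.map_add _ _).trans (max_le_max (le_gauss v f n) (le_gauss v g n))

theorem gauss_mul_le (v : Valuation K Γ) (f g : K[X]) :
    gauss v (f * g) ≤ gauss v f * gauss v g := by
  refine gauss_le_iff.2 fun n => ?_
  rw [coeff_mul]
  refine v.map_sum_le fun p _ => ?_
  rw [map_mul]
  exact mul_le_mul' (le_gauss v f _) (le_gauss v g _)

theorem gauss_C_mul (v : Valuation K Γ) (c : K) (f : K[X]) :
    gauss v (C c * f) = v c * gauss v f := by
  rcases eq_or_ne c 0 with rfl | hc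
  · simp
  have key : ∀ (c : K) (f : K[X]), gauss v (C c * f) ≤ v c * gauss v f := fun c f => by
    refine gauss_le_iff.2 fun n => ?_
    rw [coeff_C_mul, map_mul]
    exact mul_le_mul_right (le_gauss v f n) _
  refine le_antisymm (key c f) ?_
  have h := mul_le_mul_right (key c⁻¹ (C c * f)) (v c)
  rwa [← mul_assoc, ← C_mul, inv_mul_cancel₀ hc, C_1, one_mul, ← mul_assoc, ← map_mul,
    mul_inv_cancel₀ hc, map_one, one_mul] at h

theorem gauss_X_pow_mul (v : Valuation K Γ) (n : ℕ) (f : K[X]) :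
    gauss v (X ^ n * f) = gauss v f := by
  refine le_antisymm (gauss_le_iff.2 fun m => ?_) (gauss_le_iff.2 fun m => ?_)
  · rw [coeff_X_pow_mul']
    split_ifs
    · exact le_gauss v f _
    · simp
  · rw [← coeff_X_pow_mul f n m]
    exact le_gauss v _ _

/-- If `n` exceeds the degree of `f`, no cancellation takes place in `f + X ^ n * g`. -/
theorem gauss_add_X_pow_mul (v : Valuation K Γ) {n : ℕ} {f : K[X]} (g : K[X])
    (hn : f.natDegree < n) : gauss v (f + X ^ n * g) = max (gauss v f) (gauss v g) := by
  refine le_antisymm ((gauss_add_le v _ _).trans_eq (by rw [gauss_X_pow_mul]))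
    (max_le (gauss_le_iff.2 fun m => ?_) (gauss_le_iff.2 fun m => ?_))
  · by_cases hm : m < n
    · have := le_gauss v (f + X ^ n * g) m
      rwa [coeff_add, coeff_X_pow_mul', if_neg (by omega), add_zero] at this
    · rw [coeff_eq_zero_of_natDegree_lt (by omega), map_zero]
      exact zero_le
  · have := le_gauss v (f + X ^ n * g) (m + n)
    rwa [coeff_add, coeff_X_pow_mul, coeff_eq_zero_of_natDegree_lt (by omega), zero_add] at this

/-- **Gauss's lemma** for valuations. -/
theorem gauss_mul (v : Valuation K Γ) (f g : K[X]) :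
    gauss v (f * g) = gauss v f * gauss v g := by
  refine le_antisymm (gauss_mul_le v f g) ?_
  rcases eq_or_ne f 0 with rfl | hf
  · simp
  rcases eq_or_ne g 0 with rfl | hg
  · simp
  have hex : ∀ f : K[X], f ≠ 0 → ∃ n, v (f.coeff n) = gauss v f := fun f hf =>
    (exists_gauss_eq v hf).imp fun _ h => h.2
  classical
  -- the first coefficients of maximal value
  have hm := Nat.find_spec (hex f hf)
  have hk := Nat.find_spec (hex g hg)
  set m := Nat.find (hex f hf) with hm_def
  set k := Nat.find (hex g hg) with hk_def
  have hmlt : ∀ i < m, v (f.coeff i) < gauss v f := fun i hi =>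
    (le_gauss v f i).lt_of_ne (Nat.find_min (hex f hf) hi)
  have hklt : ∀ i < k, v (g.coeff i) < gauss v g := fun i hi =>
    (le_gauss v g i).lt_of_ne (Nat.find_min (hex g hg) hi)
  have hpos : 0 < gauss v f * gauss v g :=
    zero_lt_iff.2 (mul_ne_zero (gauss_pos v hf).ne' (gauss_pos v hg).ne')
  -- In degree `m + k` every other term has first index below `m` or second index below `k`, so one
  -- factor is strictly smaller than its maximum.
  have hrest : v (∑ p ∈ (Finset.HasAntidiagonal.antidiagonal (m + k)).erase (m, k), f.coeff p.1 * g.coeff p.2) <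
      gauss v f * gauss v g := by
    refine v.map_sum_lt hpos.ne' fun p hp => ?_
    obtain ⟨hne, hp⟩ := Finset.mem_erase.1 hp
    rw [Finset.HasAntidiagonal.mem_antidiagonal] at hp
    rw [map_mul]
    rcases lt_trichotomy p.1 m with h | h | h
    · exact (mul_le_mul_right (le_gauss v g _) _).trans_lt
        (mul_lt_mul_of_pos_right (hmlt _ h) (gauss_pos v hg))
    · exact absurd (Prod.ext h (by omega)) hne
    · exact (mul_le_mul_left (le_gauss v f _) _).trans_lt
        (mul_lt_mul_of_pos_left (hklt _ (by omega)) (gauss_pos v hf))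
  have hsum : (f * g).coeff (m + k) = f.coeff m * g.coeff k +
      ∑ p ∈ (Finset.HasAntidiagonal.antidiagonal (m + k)).erase (m, k), f.coeff p.1 * g.coeff p.2 := by
    rw [coeff_mul, Finset.add_sum_erase _ (fun p : ℕ × ℕ => f.coeff p.1 * g.coeff p.2)
      (by simp : (m, k) ∈ Finset.HasAntidiagonal.antidiagonal (m + k))]
  have hval : v ((f * g).coeff (m + k)) = gauss v f * gauss v g := by
    rw [hsum, v.map_add_eq_of_lt_left, map_mul, hm, hk]
    rwa [map_mul, hm, hk]
  exact hval.symm.trans_le (le_gauss v _ _)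

end Gauss

/-! ### Polynomials of unit content. -/

section Unimodular

variable {K : Type*} [Field K]

/-- The ring of polynomials over `K` all of whose coefficients lie in the subring `B`. -/
noncomputable def coeffSubring (B : Subring K) : Subring K[X] := (mapRingHom B.subtype).range

theorem mem_coeffSubring {B : Subring K} {f : K[X]} :
    f ∈ coeffSubring B ↔ ∀ n, f.coeff n ∈ B := by
  rw [coeffSubring, mem_map_range]
  simp

theorem coeffSubring_mono {A B : Subring K} (h : A ≤ B) : coeffSubring A ≤ coeffSubring B :=
  fun _ hf => mem_coeffSubring.2 fun n => h (mem_coeffSubring.1 hf n)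

theorem X_mem_coeffSubring (B : Subring K) : X ∈ coeffSubring B :=
  mem_coeffSubring.2 fun n => by
    rw [coeff_X]; split_ifs
    exacts [B.one_mem, B.zero_mem]

theorem C_mem_coeffSubring {B : Subring K} {c : K} : C c ∈ coeffSubring B ↔ c ∈ B := by
  refine ⟨fun h => by simpa using mem_coeffSubring.1 h 0, fun h => mem_coeffSubring.2 fun n => ?_⟩
  rw [coeff_C]; split_ifs
  exacts [h, B.zero_mem]

theorem monomial_mem_coeffSubring {B : Subring K} {c : K} (n : ℕ) (h : c ∈ B) :
    monomial n c ∈ coeffSubring B := by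
  rw [← C_mul_X_pow_eq_monomial]
  exact mul_mem (C_mem_coeffSubring.2 h) (pow_mem (X_mem_coeffSubring B) n)

/-- A polynomial over `B` is unimodular if its coefficients generate the unit ideal of `B`; in
other words, if some multiple of it over `B` has `1` among its coefficients. -/
def IsUnimodular (B : Subring K) (g : K[X]) : Prop :=
  g ∈ coeffSubring B ∧ ∃ a ∈ coeffSubring B, ∃ m, (a * g).coeff m = 1

theorem IsUnimodular.mono {A B : Subring K} (h : A ≤ B) {g : K[X]} (hg : IsUnimodular A g) :
    IsUnimodular B g := by
  obtain ⟨h1, a, ha, m, hm⟩ := hg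
  exact ⟨coeffSubring_mono h h1, a, coeffSubring_mono h ha, m, hm⟩

theorem isUnimodular_of_coeff_eq_one {B : Subring K} {g : K[X]} (hg : g ∈ coeffSubring B) {m : ℕ}
    (h : g.coeff m = 1) : IsUnimodular B g :=
  ⟨hg, 1, one_mem _, m, by rwa [one_mul]⟩

/-- A `B`-linear combination of the coefficients is a coefficient of a multiple. -/
theorem exists_coeff_mul_eq_sum (a : ℕ → K) (B : Subring K) (ha : ∀ i, a i ∈ B) (g : K[X]) :
    ∃ d ∈ coeffSubring B, (d * g).coeff g.natDegree =
      ∑ i ∈ Finset.range (g.natDegree + 1), a i * g.coeff i := by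
  refine ⟨∑ i ∈ Finset.range (g.natDegree + 1), monomial (g.natDegree - i) (a i),
    sum_mem fun i _ => monomial_mem_coeffSubring _ (ha i), ?_⟩
  rw [Finset.sum_mul, finsetSum_coeff]
  refine Finset.sum_congr rfl fun i hi => ?_
  have hi' : i + (g.natDegree - i) = g.natDegree := by
    have := Finset.mem_range.1 hi
    omega
  simpa only [hi'] using coeff_monomial_mul g (g.natDegree - i) i (a i)

theorem isUnimodular_map_iff {B : Subring K} {g : B[X]} :
    IsUnimodular B (g.map B.subtype) ↔ g.contentIdeal = ⊤ := by
  constructor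
  · rintro ⟨-, a, ⟨a, rfl⟩, m, hm⟩
    rw [coe_mapRingHom, ← Polynomial.map_mul, coeff_map] at hm
    have h1 : (a * g).coeff m = 1 := Subtype.ext hm
    rw [mul_comm] at h1
    exact contentIdeal_eq_top_of_contentIdeal_mul_eq_top (contentIdeal_eq_top_of_coeff h1)
  · intro h
    refine ⟨⟨g, rfl⟩, ?_⟩
    have h1 : (1 : B) ∈ g.contentIdeal := h ▸ Submodule.mem_top
    have hle : g.contentIdeal ≤ Ideal.span (Set.range g.coeff) := by
      rw [contentIdeal_def]
      refine Ideal.span_mono fun x hx => ?_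
      obtain ⟨n, -, rfl⟩ := mem_coeffs_iff.1 hx
      exact ⟨n, rfl⟩
    obtain ⟨c, hc⟩ := (Finsupp.mem_ideal_span_range_iff_exists_finsupp).1 (hle h1)
    -- The coefficients `c i` in reversed order, so that all products `c i * g.coeff i` meet in one
    -- degree. The top index is that of the support of `c`, which may exceed the degree of `g`.
    refine ⟨∑ i ∈ c.support, monomial (c.support.sup id - i) (c i : K),
      sum_mem fun i _ => monomial_mem_coeffSubring _ (c i).2, c.support.sup id, ?_⟩
    rw [Finset.sum_mul, finsetSum_coeff]
    have h2 := congrArg (Subtype.val) hc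
    rw [Finsupp.sum, AddSubmonoidClass.coe_finsetSum] at h2
    refine Eq.trans ?_ h2
    refine Finset.sum_congr rfl fun i hi => ?_
    have hi' : i + (c.support.sup id - i) = c.support.sup id := by
      have : i ≤ c.support.sup id := Finset.le_sup (f := id) hi
      omega
    have h3 := coeff_monomial_mul (g.map B.subtype) (c.support.sup id - i) i (c i : K)
    rw [hi', coeff_map] at h3
    exact h3

theorem IsUnimodular.mul {B : Subring K} {f g : K[X]} (hf : IsUnimodular B f)
    (hg : IsUnimodular B g) : IsUnimodular B (f * g) := by
  obtain ⟨f, rfl⟩ := hf.1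
  obtain ⟨g, rfl⟩ := hg.1
  rw [coe_mapRingHom, isUnimodular_map_iff] at hf hg
  rw [coe_mapRingHom, ← Polynomial.map_mul, isUnimodular_map_iff]
  exact contentIdeal_mul_eq_top_of_contentIdeal_eq_top hf hg

/-- If `a g` has `1` in degree `m` and `n` exceeds the degree of `a f`, then in `a (f + X ^ n g)`
the coefficient in degree `m + n` is untouched by `a f`. This replaces a numerator by a unimodular
one. -/
theorem IsUnimodular.exists_add_X_pow_mul {B : Subring K} {f g : K[X]} (hf : f ∈ coeffSubring B)
    (hg : IsUnimodular B g) : ∃ N, ∀ n, N ≤ n → IsUnimodular B (f + X ^ n * g) := by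
  obtain ⟨hgB, a, ha, m, hm⟩ := hg
  refine ⟨(a * f).natDegree + 1, fun n hn => ⟨add_mem hf (mul_mem
    (pow_mem (X_mem_coeffSubring B) n) hgB), a, ha, m + n, ?_⟩⟩
  rw [mul_add, mul_left_comm, coeff_add, coeff_X_pow_mul, hm,
    coeff_eq_zero_of_natDegree_lt (by omega), zero_add]

theorem IsUnimodular.ne_zero {B : Subring K} {g : K[X]} (hg : IsUnimodular B g) : g ≠ 0 := by
  rintro rfl
  obtain ⟨-, a, -, m, hm⟩ := hg
  simp at hm

theorem gauss_le_one_of_mem {Γ : Type*} [LinearOrderedCommGroupWithZero Γ] {v : Valuation K Γ}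
    {B : Subring K} (hB : ∀ x ∈ B, v x ≤ 1) {f : K[X]} (hf : f ∈ coeffSubring B) :
    gauss v f ≤ 1 :=
  gauss_le_iff.2 fun n => hB _ (mem_coeffSubring.1 hf n)

theorem IsUnimodular.gauss_eq_one_of_le {Γ : Type*} [LinearOrderedCommGroupWithZero Γ]
    {v : Valuation K Γ} {B : Subring K} (hB : ∀ x ∈ B, v x ≤ 1) {g : K[X]}
    (hg : IsUnimodular B g) : gauss v g = 1 := by
  refine le_antisymm (gauss_le_one_of_mem hB hg.1) ?_
  obtain ⟨hgB, a, ha, m, hm⟩ := hg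
  have h := le_gauss v (a * g) m
  rw [hm, map_one] at h
  exact h.trans ((gauss_mul_le _ _ _).trans
    (mul_le_of_le_one_left' (gauss_le_one_of_mem hB ha)))

theorem IsUnimodular.gauss_eq_one {V : ValuationSubring K} {B : Subring K}
    (hB : B ≤ V.toSubring) {g : K[X]} (hg : IsUnimodular B g) : gauss V.valuation g = 1 :=
  hg.gauss_eq_one_of_le fun x hx => (V.valuation_le_one_iff x).2 (hB hx)

end Unimodular

/-! ### Membership in Nagata rings and in `R'` through Gauss norms. -/

section NagataRing

variable {K : Type*} [Field K]

local notation "ι" => algebraMap (Polynomial K) (RatFunc K)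

theorem algebraMap_poly_ne_zero {g : K[X]} (hg : g ≠ 0) : ι g ≠ 0 := by
  simpa using hg

theorem mem_nagata {B : Subring K} {φ : RatFunc K} :
    φ ∈ nagata B ↔ ∃ f ∈ coeffSubring B, ∃ g, IsUnimodular B g ∧ φ = ι f / ι g := by
  constructor
  · rintro ⟨f, g, hg, rfl⟩
    exact ⟨_, ⟨f, rfl⟩, _, isUnimodular_map_iff.2 hg, rfl⟩
  · rintro ⟨_, ⟨f, rfl⟩, g, hg, rfl⟩
    obtain ⟨g, rfl⟩ := hg.1
    exact ⟨f, g, isUnimodular_map_iff.1 hg, rfl⟩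

theorem algebraMap_mem_nagata {B : Subring K} {f : K[X]} (hf : f ∈ coeffSubring B) :
    ι f ∈ nagata B :=
  mem_nagata.2 ⟨f, hf, 1, isUnimodular_of_coeff_eq_one (one_mem _) (m := 0) (by simp), by simp⟩

theorem inv_algebraMap_mem_nagata {B : Subring K} {g : K[X]} (hg : IsUnimodular B g) :
    (ι g)⁻¹ ∈ nagata B :=
  mem_nagata.2 ⟨1, one_mem _, g, hg, by simp⟩

theorem mem_trivialExtension {V : ValuationSubring K} {φ : RatFunc K} :
    φ ∈ trivialExtension V ↔ φ ∈ nagata V.toSubring := Iff.rfl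

/-- An element of `K(t)` lies in `V(t)` if and only if the Gauss norm of its numerator is at most
that of its denominator. -/
theorem div_mem_nagata_iff (V : ValuationSubring K) (f : K[X]) {g : K[X]} (hg : g ≠ 0) :
    ι f / ι g ∈ nagata V.toSubring ↔ gauss V.valuation f ≤ gauss V.valuation g := by
  constructor
  · intro h
    obtain ⟨f', hf', g', hg', h⟩ := mem_nagata.1 h
    rw [div_eq_div_iff (algebraMap_poly_ne_zero hg) (algebraMap_poly_ne_zero hg'.ne_zero),
      ← map_mul, ← map_mul] at h
    have h := congrArg (gauss V.valuation) (RatFunc.algebraMap_injective K h)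
    rw [gauss_mul, gauss_mul, hg'.gauss_eq_one le_rfl, mul_one] at h
    rw [h]
    exact mul_le_of_le_one_left' (gauss_le_iff.2 fun n =>
      (V.valuation_le_one_iff _).2 (mem_coeffSubring.1 hf' n))
  · intro h
    obtain ⟨n, hn, hng⟩ := exists_gauss_eq V.valuation hg
    have hmem : ∀ r : K[X], gauss V.valuation r ≤ gauss V.valuation g →
        C (g.coeff n)⁻¹ * r ∈ coeffSubring V.toSubring := fun r hr =>
      mem_coeffSubring.2 fun m => (V.valuation_le_one_iff _).1 <| (le_gauss _ _ m).trans <| by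
        rw [gauss_C_mul, map_inv₀, hng]
        exact inv_mul_le_of_le_mul₀ zero_le zero_le (by rwa [mul_one])
    refine mem_nagata.2 ⟨_, hmem f h, _, isUnimodular_of_coeff_eq_one (hmem g le_rfl) (m := n)
      (by rw [coeff_C_mul, inv_mul_cancel₀ hn]), ?_⟩
    rw [map_mul, map_mul, mul_div_mul_left]
    exact algebraMap_poly_ne_zero (C_ne_zero.2 (inv_ne_zero hn))

/-- Membership in the maximal ideal of a valuation ring, in terms of inverses. -/
theorem valuation_lt_one_iff_inv_notMem {L : Type*} [Field L] (W : ValuationSubring L) {x : L}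
    (hx : x ≠ 0) : W.valuation x < 1 ↔ x⁻¹ ∉ W := by
  rw [← W.valuation_le_one_iff, map_inv₀, not_le, one_lt_inv₀]
  exact zero_lt_iff.2 ((W.valuation.ne_zero_iff).2 hx)

theorem valuation_trivialExtension_lt_one_iff (V : ValuationSubring K) (f : K[X]) {g : K[X]}
    (hg : g ≠ 0) : (trivialExtension V).valuation (ι f / ι g) < 1 ↔
      gauss V.valuation f < gauss V.valuation g := by
  rcases eq_or_ne f 0 with rfl | hf
  · simpa using gauss_pos _ hg
  · rw [valuation_lt_one_iff_inv_notMem _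
      (div_ne_zero (algebraMap_poly_ne_zero hf) (algebraMap_poly_ne_zero hg)), inv_div,
      mem_trivialExtension, div_mem_nagata_iff V g hf, not_le]

theorem mem_kronecker {B : Subring K} {φ : RatFunc K} :
    φ ∈ kronecker B ↔ ∀ V : ValuationSubring K, B ≤ V.toSubring → φ ∈ nagata V.toSubring := by
  simp [kronecker, Subring.mem_iInf]

theorem le_intClosure {L : Type*} [Field L] (B : Subring L) : B ≤ intClosure B := fun x hx =>
  (integralClosure B L).algebraMap_mem ⟨x, hx⟩

/-- Valuation rings are integrally closed, so those above `D` and those above its integral closure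
are the same. -/
theorem mem_krNagata {D A : Subring K} {φ : RatFunc K} :
    φ ∈ krNagata D A ↔
      (∀ V : ValuationSubring K, D ≤ V.toSubring → φ ∈ nagata V.toSubring) ∧ φ ∈ nagata A := by
  rw [krNagata, Subring.mem_inf, mem_kronecker]
  exact and_congr_left fun _ =>
    ⟨fun h V hV => h V (intClosure_le hV), fun h V hV => h V ((le_intClosure D).trans hV)⟩

theorem div_mem_krNagata {D A : Subring K} {f g : K[X]} (hf : f ∈ coeffSubring A)
    (hg : IsUnimodular A g) (h : ∀ V : ValuationSubring K, D ≤ V.toSubring →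
      gauss V.valuation f ≤ gauss V.valuation g) : ι f / ι g ∈ krNagata D A :=
  mem_krNagata.2 ⟨fun V hV => (div_mem_nagata_iff V f hg.ne_zero).2 (h V hV),
    mem_nagata.2 ⟨f, hf, g, hg, rfl⟩⟩

theorem gauss_one {Γ : Type*} [LinearOrderedCommGroupWithZero Γ] (v : Valuation K Γ) :
    gauss v (1 : K[X]) = 1 := by
  have h := le_gauss v (1 : K[X]) 0
  rw [coeff_one_zero, map_one] at h
  refine le_antisymm (gauss_le_iff.2 fun n => ?_) h
  rw [coeff_one]; split_ifs <;> simp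

theorem gauss_C {Γ : Type*} [LinearOrderedCommGroupWithZero Γ] (v : Valuation K Γ) (x : K) :
    gauss v (C x) = v x := by
  rw [← mul_one (C x), gauss_C_mul, gauss_one, mul_one]

theorem X_mem_krNagata (D A : Subring K) : ι X ∈ krNagata D A :=
  mem_krNagata.2 ⟨fun _ _ => algebraMap_mem_nagata (X_mem_coeffSubring _),
    algebraMap_mem_nagata (X_mem_coeffSubring _)⟩

theorem C_mul_X_add_one_isUnimodular {B : Subring K} {x : K} (hx : x ∈ B) :
    IsUnimodular B (C x * X + 1) :=
  isUnimodular_of_coeff_eq_one (m := 0) (add_mem (mul_mem (C_mem_coeffSubring.2 hx)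
    (X_mem_coeffSubring B)) (one_mem _)) (by simp)

theorem gauss_C_mul_X_add_one {Γ : Type*} [LinearOrderedCommGroupWithZero Γ] (v : Valuation K Γ)
    (x : K) : gauss v (C x * X + 1) = max 1 (v x) := by
  have h := gauss_add_X_pow_mul v (n := 1) (f := (1 : K[X])) (C x) (by simp)
  rwa [pow_one, gauss_one, gauss_C, add_comm, mul_comm] at h

/-- For `x ∈ A`, the elements `1 / (1 + x t)` and `x / (1 + x t)` belong to `R'`. -/
theorem inv_mem_krNagata (D : Subring K) {A : Subring K} {x : K} (hx : x ∈ A) :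
    ι 1 / ι (C x * X + 1) ∈ krNagata D A ∧ ι (C x) / ι (C x * X + 1) ∈ krNagata D A := by
  refine ⟨div_mem_krNagata (one_mem _) (C_mul_X_add_one_isUnimodular hx) fun V _ => ?_,
    div_mem_krNagata (C_mem_coeffSubring.2 hx) (C_mul_X_add_one_isUnimodular hx) fun V _ => ?_⟩
  · rw [gauss_one, gauss_C_mul_X_add_one]
    exact le_max_left _ _
  · rw [gauss_C, gauss_C_mul_X_add_one]
    exact le_max_right _ _

end NagataRing

/-! ### Localizations as subrings of the field. -/

section Localization

variable {L : Type*} [Field L]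

theorem mem_localizationAt {B : Subring L} {P : Ideal B} [P.IsPrime] {x : L} :
    x ∈ localizationAt B P ↔ ∃ a b : B, b ∉ P ∧ x = a / b := by
  constructor
  · intro hx
    obtain ⟨⟨a, b⟩, h⟩ := IsLocalization.surj (M := P.primeCompl)
      (⟨x, hx⟩ : (LocalSubring.ofPrime B P).toSubring)
    refine ⟨a, b, b.2, ?_⟩
    have h := congrArg Subtype.val h
    have hb : ((b : B) : L) ≠ 0 := fun h0 => b.2 (by
      rw [show (b : B) = 0 from Subtype.ext h0]; exact P.zero_mem)
    rw [eq_div_iff hb]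
    exact h
  · rintro ⟨a, b, hb, rfl⟩
    have hu : IsUnit (algebraMap B (LocalSubring.ofPrime B P).toSubring b) :=
      IsLocalization.map_units (M := P.primeCompl) _ ⟨b, hb⟩
    obtain ⟨c, hc⟩ := hu.exists_right_inv
    have hc := congrArg Subtype.val hc
    have hc' : (b : L) * c = 1 := hc
    rw [div_eq_mul_inv, ← eq_inv_of_mul_eq_one_right hc']
    exact mul_mem (LocalSubring.le_ofPrime B P a.2) c.2

theorem mem_center {V : ValuationSubring L} {B : Subring L} {h : B ≤ V.toSubring} {x : B} :
    x ∈ center V B h ↔ V.valuation (x : L) < 1 :=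
  V.valuation_lt_one_iff (Subring.inclusion h x)

end Localization

/-! ### Avoidance of residue classes and of submodules. -/

section Avoidance

/-- If every residue field of `R` has more than `T.card` elements, then `T.card` residue classes
modulo proper ideals do not cover `R`. -/
theorem exists_forall_sub_notMem {R ι : Type*} [CommRing R] (T : Finset ι) (P : ι → Ideal R)
    (hP : ∀ i ∈ T, P i ≠ ⊤) (c : ι → R)
    (hres : ∀ M : Ideal R, M.IsMaximal → (T.card : ℕ∞) < ENat.card (R ⧸ M)) :
    ∃ d, ∀ i ∈ T, d - c i ∉ P i := by
  classical
  have hM : ∀ i : T, ∃ M : Ideal R, M.IsMaximal ∧ P i ≤ M := fun i =>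
    Ideal.exists_le_maximal _ (hP i i.2)
  choose M hM hPM using hM
  -- Different `i` may share a maximal ideal. Working over the range of `M` makes the ideals
  -- distinct, hence pairwise coprime, so that the Chinese remainder theorem applies.
  have hclass : ∀ J : Set.range M, ∃ e : R, ∀ i ∈ T, e - c i ∉ (J : Ideal R) := by
    rintro ⟨_, j, rfl⟩
    obtain ⟨x, hx⟩ : ∃ x, x ∉ T.image fun i => Ideal.Quotient.mk (M j) (c i) := by
      by_contra! hall
      have h1 : ENat.card (R ⧸ M j) ≤ (T.image fun i => Ideal.Quotient.mk (M j) (c i)).card := by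
        rw [← Set.encard_univ, ← Set.encard_coe_eq_coe_finsetCard]
        exact Set.encard_le_encard fun x _ => hall x
      exact absurd (hres _ (hM j)) (not_lt.2 (h1.trans (by exact_mod_cast Finset.card_image_le)))
    obtain ⟨e, rfl⟩ := Ideal.Quotient.mk_surjective x
    refine ⟨e, fun i hi hmem => hx (Finset.mem_image.2 ⟨i, hi, ?_⟩)⟩
    exact (Ideal.Quotient.eq.2 hmem).symm
  choose e he using hclass
  have hcop : Pairwise (Function.onFun IsCoprime fun J : Set.range M => (J : Ideal R)) := by
    rintro ⟨_, i, rfl⟩ ⟨_, j, rfl⟩ hne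
    have := hM i
    have := hM j
    exact Ideal.isCoprime_of_isMaximal fun h => hne (Subtype.ext h)
  obtain ⟨d, hd⟩ := Ideal.exists_forall_sub_mem_ideal hcop e
  refine ⟨d, fun i hi hmem => he ⟨_, ⟨i, hi⟩, rfl⟩ i hi ?_⟩
  have h1 := hd ⟨_, ⟨i, hi⟩, rfl⟩
  have h2 := sub_mem (hPM ⟨i, hi⟩ hmem) h1
  simpa using h2

/-- A module over a ring with large residue fields is not covered by few proper submodules, if
each of them is saturated with respect to a proper ideal. -/
theorem exists_forall_notMem {R M ι : Type*} [CommRing R] [AddCommGroup M] [Module R M]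
    (T : Finset ι) (P : ι → Ideal R) (hP : ∀ i ∈ T, P i ≠ ⊤) (N : ι → Submodule R M)
    (hN : ∀ i ∈ T, ∀ a ∉ P i, ∀ y, a • y ∈ N i → y ∈ N i) (hne : ∀ i ∈ T, ∃ y, y ∉ N i)
    (hres : ∀ M : Ideal R, M.IsMaximal → (T.card : ℕ∞) ≤ ENat.card (R ⧸ M)) :
    ∃ y, ∀ i ∈ T, y ∉ N i := by
  classical
  induction T using Finset.induction_on with
  | empty => exact ⟨0, by simp⟩
  | insert j T hj ih =>
    rw [Finset.card_insert_of_notMem hj] at hres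
    simp only [Finset.forall_mem_insert] at hP hN hne
    obtain ⟨z, hz⟩ := ih hP.2 hN.2 hne.2
      fun M hM => le_trans (by exact_mod_cast Nat.le_succ _) (hres M hM)
    by_cases hzj : z ∈ N j
    -- No `y + d • z` lies in `N j`. For `i ∈ T`, saturation and `z ∉ N i` put all `d` with `y + d •
    -- z ∈ N i` into one class modulo `P i`, so only `T.card` classes must be avoided, one fewer
    -- than the residue fields have elements.
    · obtain ⟨y, hy⟩ := hne.1
      obtain ⟨d, hd⟩ := exists_forall_sub_notMem T P hP.2
        (fun i => if h : ∃ d : R, y + d • z ∈ N i then h.choose else 0)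
        fun M hM => lt_of_lt_of_le (by exact_mod_cast Nat.lt_succ_self _) (hres M hM)
      refine ⟨y + d • z, Finset.forall_mem_insert _ _ _ |>.2 ⟨fun h => hy ?_, fun i hi h => ?_⟩⟩
      · exact (add_mem_cancel_right ((N j).smul_mem d hzj)).1 h
      · have hex : ∃ d : R, y + d • z ∈ N i := ⟨d, h⟩
        have hdi := hd i hi
        rw [dif_pos hex] at hdi
        refine hz i hi (hN.2 i hi _ hdi z ?_)
        have := sub_mem h hex.choose_spec
        rwa [add_sub_add_left_eq_sub, ← sub_smul] at this
    · exact ⟨z, Finset.forall_mem_insert _ _ _ |>.2 ⟨hzj, hz⟩⟩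

variable {K : Type*} [Field K]

/-- If the residue fields of `D` have at least `T.card` elements, then a suitable `D`-linear
combination of the coefficients of `g` has, for each of the valuation rings `V i ⊇ D`, `i ∈ T`, the
largest value that occurs among the coefficients. -/
theorem exists_combination_valuation_eq_gauss {ι : Type*} (D : Subring K) (T : Finset ι)
    (V : ι → ValuationSubring K) (hV : ∀ i ∈ T, D ≤ (V i).toSubring) {g : K[X]} (hg : g ≠ 0)
    (hres : ∀ M : Ideal D, M.IsMaximal → (T.card : ℕ∞) ≤ ENat.card (D ⧸ M)) :
    ∃ a : ℕ → K, (∀ j, a j ∈ D) ∧ ∀ i ∈ T, (V i).valuation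
      (∑ j ∈ Finset.range (g.natDegree + 1), a j * g.coeff j) = gauss (V i).valuation g := by
  classical
  let F : (ℕ → D) → K := fun a => ∑ j ∈ Finset.range (g.natDegree + 1), (a j : K) * g.coeff j
  have hFadd : ∀ a b, F (a + b) = F a + F b := fun a b => by
    simp [F, add_mul, Finset.sum_add_distrib]
  have hFsmul : ∀ (c : D) a, F (c • a) = c * F a := fun c a => by
    simp [F, mul_assoc, Finset.mul_sum]
  have hDV : ∀ i ∈ T, ∀ c : D, (V i).valuation (c : K) ≤ 1 := fun i hi c =>
    ((V i).valuation_le_one_iff _).2 (hV i hi c.2)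
  -- The coefficient vectors whose combination falls short of the Gauss norm at `V i`. They form a
  -- submodule saturated with respect to the center of `V i`, since elements outside the center have
  -- value `1`.
  let N : ι → Submodule D (ℕ → D) := fun i => if hi : i ∈ T then
    { carrier := {a | (V i).valuation (F a) < gauss (V i).valuation g}
      add_mem' := fun {a b} ha hb => by
        rw [Set.mem_ofPred_eq, hFadd]
        exact (Valuation.map_add _ _ _).trans_lt (max_lt ha hb)
      zero_mem' := by
        have : F 0 = 0 := by simp [F]
        rw [Set.mem_ofPred_eq, this, map_zero]
        exact gauss_pos _ hg
      smul_mem' := fun c a ha => by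
        rw [Set.mem_ofPred_eq, hFsmul, map_mul]
        exact (mul_le_of_le_one_left' (hDV i hi c)).trans_lt ha } else ⊤
  have hNmem : ∀ i ∈ T, ∀ a, a ∈ N i ↔ (V i).valuation (F a) < gauss (V i).valuation g :=
    fun i hi a => by simp only [N, dif_pos hi]; rfl
  let P : ι → Ideal D := fun i => if hi : i ∈ T then center (V i) D (hV i hi) else ⊤
  have hPeq : ∀ i (hi : i ∈ T), P i = center (V i) D (hV i hi) := fun i hi => dif_pos hi
  obtain ⟨a, ha⟩ := exists_forall_notMem T P
    (fun i hi => by rw [hPeq i hi]; exact (center_isPrime _ _ _).ne_top) N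
    (fun i hi c hc a hca => by
      rw [hPeq i hi, mem_center, not_lt] at hc
      rw [hNmem i hi, hFsmul, map_mul, le_antisymm (hDV i hi c) hc, one_mul] at hca
      exact (hNmem i hi a).2 hca)
    (fun i hi => by
      obtain ⟨n, hn0, hn⟩ := exists_gauss_eq (V i).valuation hg
      refine ⟨Pi.single n 1, fun h => ?_⟩
      have hF : F (Pi.single n 1) = g.coeff n := by
        have hmem : n ∈ Finset.range (g.natDegree + 1) :=
          Finset.mem_range.2 (Nat.lt_succ_of_le (le_natDegree_of_ne_zero hn0))
        simp only [F]
        rw [Finset.sum_eq_single_of_mem n hmem fun j _ hj => by simp [hj]]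
        simp
      rw [hNmem i hi, hF, hn] at h
      exact h.false) hres
  refine ⟨fun j => a j, fun j => (a j).2, fun i hi => le_antisymm ?_ ?_⟩
  · refine Valuation.map_sum_le _ fun j _ => ?_
    rw [map_mul]
    exact (mul_le_of_le_one_left' (hDV i hi (a j))).trans (le_gauss _ _ _)
  · exact not_lt.1 fun h => ha i hi ((hNmem i hi a).2 h)

end Avoidance

/-! ### Unit combinations and the inclusion of `R'` in `(A ∩ V)(t)`. -/

section Semilocal

variable {K : Type*} [Field K]

/-- Every maximal ideal of `B` is the center on `B` of a valuation ring. -/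
theorem exists_valuationSubring_forall_mem_iff {L : Type*} [Field L] (B : Subring L) (M : Ideal B)
    [hM : M.IsMaximal] :
    ∃ V : ValuationSubring L, B ≤ V.toSubring ∧
      ∀ x : B, x ∈ M ↔ V.valuation (x : L) < 1 := by
  obtain ⟨V, hBV, hV⟩ := Ideal.image_subset_nonunits_valuationSubring M hM.ne_top
  refine ⟨V, hBV, fun x => ?_⟩
  have hle : M ≤ center V B hBV := fun y hy =>
    mem_center.2 (V.mem_nonunits_iff.1 (hV ⟨y, hy, rfl⟩))
  rw [hM.eq_of_le (center_isPrime V B hBV).ne_top hle, mem_center]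

/-- An element of `A` is a unit of `A` if it lies in no maximal ideal of the integral closure. -/
theorem inv_mem_of_forall_notMem {A : Subring K} {y : K} (hy : y ∈ A)
    (h : ∀ M : Ideal (intClosure A), M.IsMaximal → (⟨y, le_intClosure A hy⟩ : intClosure A) ∉ M) :
    y⁻¹ ∈ A := by
  obtain ⟨⟨z, hz⟩, hyz'⟩ : ∃ z, (⟨y, le_intClosure A hy⟩ : intClosure A) * z = 1 := by
    have : IsUnit (⟨y, le_intClosure A hy⟩ : intClosure A) := by
      by_contra hcon
      obtain ⟨M, hM, hyM⟩ := exists_max_ideal_of_mem_nonunits hcon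
      exact h M hM hyM
    exact this.exists_right_inv
  have hyz : y * z = 1 := congrArg Subtype.val hyz'
  rw [← eq_inv_of_mul_eq_one_right hyz]
  obtain ⟨p, hp, hpz⟩ := hz
  -- multiply the equation `p(z) = 0` by a power of `y`
  have key : ∀ n : ℕ, ∀ c : ℕ → A, z ^ (n + 1) = ∑ i ∈ Finset.range (n + 1), (c i : K) * z ^ i →
      z ∈ A := by
    intro n c hc
    have h1 : z = ∑ i ∈ Finset.range (n + 1), (c i : K) * y ^ (n - i) := by
      have h2 : z = y ^ n * z ^ (n + 1) := by
        rw [pow_succ, ← mul_assoc, ← mul_pow, hyz, one_pow, one_mul]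
      rw [h2, hc, Finset.mul_sum]
      refine Finset.sum_congr rfl fun i hi => ?_
      have hin : n = (n - i) + i := by
        have := Finset.mem_range.1 hi
        omega
      rw [mul_left_comm]
      congr 1
      conv_lhs => rw [hin]
      rw [pow_add, mul_assoc, ← mul_pow, hyz, one_pow, mul_one]
    rw [h1]
    exact sum_mem fun i _ => mul_mem (c i).2 (pow_mem hy _)
  rcases Nat.eq_zero_or_pos p.natDegree with h0 | h0
  · rw [hp.natDegree_eq_zero.1 h0] at hpz
    simp at hpz
  · obtain ⟨n, hn⟩ := Nat.exists_eq_add_of_lt h0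
    rw [zero_add] at hn
    refine key n (fun i => -p.coeff i) ?_
    rw [eval₂_eq_sum_range, Finset.sum_range_succ, hp.coeff_natDegree, hn] at hpz
    simp only [map_one, one_mul] at hpz
    rw [eq_neg_of_add_eq_zero_right hpz, ← Finset.sum_neg_distrib]
    exact Finset.sum_congr rfl fun i _ => (neg_mul _ _).symm

/-- If the integral closure of `A` has at most `s` maximal ideals and the residue fields of `D` have
at least `s + 1` elements, then for every nonzero `g ∈ K[t]` whose coefficients generate the unit
ideal in `A` and every valuation ring `V ⊇ D`, some `D`-linear combination `y` of the coefficients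
is a unit of `A` and has the same value as `g` with respect to `V`. -/
theorem exists_combination_unit {D A : Subring K} (hDA : D ≤ A)
    (hA : Finite (MaximalSpectrum (intClosure A)))
    (hres : ∀ M : Ideal D, M.IsMaximal →
      ((Nat.card (MaximalSpectrum (intClosure A)) + 1 : ℕ) : ℕ∞) ≤ ENat.card (D ⧸ M))
    {V : ValuationSubring K} (hV : D ≤ V.toSubring) {g : K[X]} (hg : IsUnimodular A g) :
    ∃ a : ℕ → K, (∀ j, a j ∈ D) ∧ ∃ y : K,
      y = ∑ j ∈ Finset.range (g.natDegree + 1), a j * g.coeff j ∧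
      y ∈ A ∧ y⁻¹ ∈ A ∧ V.valuation y = gauss V.valuation g := by
  have hex := fun M : MaximalSpectrum (intClosure A) =>
    haveI := M.isMaximal
    exists_valuationSubring_forall_mem_iff (intClosure A) M.asIdeal
  choose U hU hUM using hex
  have := Fintype.ofFinite (MaximalSpectrum (intClosure A))
  have hAU : ∀ M, A ≤ (U M).toSubring := fun M => (le_intClosure A).trans (hU M)
  -- `none` stands for `V` and `some M` for the valuation ring centered on `M`: this is where the `+
  -- 1` in the residue field bound is spent.
  obtain ⟨a, haD, ha⟩ := exists_combination_valuation_eq_gauss D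
    (Finset.univ : Finset (Option (MaximalSpectrum (intClosure A)))) (fun o => o.elim V U)
    (by rintro (_ | M) -; exacts [hV, hDA.trans (hAU M)]) hg.ne_zero
    (by simpa [Nat.card_eq_fintype_card] using hres)
  have hyA : ∑ j ∈ Finset.range (g.natDegree + 1), a j * g.coeff j ∈ A :=
    sum_mem fun j _ => mul_mem (hDA (haD j)) (mem_coeffSubring.1 hg.1 j)
  refine ⟨a, haD, _, rfl, hyA, inv_mem_of_forall_notMem hyA fun M hM hmem => ?_,
    ha none (Finset.mem_univ _)⟩
  have h1 := (hUM ⟨M, hM⟩ _).1 hmem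
  have h2 := ha (some ⟨M, hM⟩) (Finset.mem_univ _)
  simp only [Option.elim_some] at h2
  exact (h2.trans (hg.gauss_eq_one (hAU _))).not_lt h1

/-- `V(t) ∩ A(t) ⊆ (A ∩ V)(t)`. -/
theorem mem_nagata_inf {D A : Subring K} (hDA : D ≤ A)
    (hA : Finite (MaximalSpectrum (intClosure A)))
    (hres : ∀ M : Ideal D, M.IsMaximal →
      ((Nat.card (MaximalSpectrum (intClosure A)) + 1 : ℕ) : ℕ∞) ≤ ENat.card (D ⧸ M))
    {V : ValuationSubring K} (hV : D ≤ V.toSubring) {φ : RatFunc K} (hφA : φ ∈ nagata A)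
    (hφV : φ ∈ nagata V.toSubring) : φ ∈ nagata (A ⊓ V.toSubring) := by
  obtain ⟨f, hf, g, hg, rfl⟩ := mem_nagata.1 hφA
  rw [div_mem_nagata_iff V f hg.ne_zero] at hφV
  obtain ⟨a, haD, y, hy, -, hyA, hyV⟩ := exists_combination_unit hDA hA hres hV hg
  have hy0 : y ≠ 0 := fun h0 => (gauss_pos V.valuation hg.ne_zero).ne'
    (by rw [← hyV, h0, map_zero])
  have hmem : ∀ r ∈ coeffSubring A, gauss V.valuation r ≤ gauss V.valuation g →
      C y⁻¹ * r ∈ coeffSubring (A ⊓ V.toSubring) := fun r hr hle =>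
    mem_coeffSubring.2 fun n => by
      refine ⟨?_, (V.valuation_le_one_iff _).1 ((le_gauss _ _ n).trans ?_)⟩
      · rw [coeff_C_mul]
        exact mul_mem hyA (mem_coeffSubring.1 hr n)
      · rw [gauss_C_mul, map_inv₀, hyV]
        exact inv_mul_le_of_le_mul₀ zero_le zero_le (by rwa [mul_one])
  obtain ⟨d, hd, hdg⟩ := exists_coeff_mul_eq_sum a D haD g
  -- Numerator and denominator are divided by `y`. The combination giving `y` has coefficients in `D
  -- ⊆ A ∩ V`, so it now exhibits `1` and the new denominator is unimodular over `A ∩ V`.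
  refine mem_nagata.2 ⟨_, hmem f hf hφV, _, ⟨hmem g hg.1 le_rfl, d,
    coeffSubring_mono (le_inf hDA hV) hd, g.natDegree, ?_⟩, ?_⟩
  · rw [mul_left_comm, coeff_C_mul, hdg, ← hy, inv_mul_cancel₀ hy0]
  · rw [map_mul, map_mul, mul_div_mul_left]
    exact algebraMap_poly_ne_zero (C_ne_zero.2 (inv_ne_zero hy0))

theorem krNagata_le_nagata_inf {D A : Subring K} (hDA : D ≤ A)
    (hA : Finite (MaximalSpectrum (intClosure A)))
    (hres : ∀ M : Ideal D, M.IsMaximal →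
      ((Nat.card (MaximalSpectrum (intClosure A)) + 1 : ℕ) : ℕ∞) ≤ ENat.card (D ⧸ M))
    {V : ValuationSubring K} (hV : D ≤ V.toSubring) :
    krNagata D A ≤ nagata (A ⊓ V.toSubring) := fun _ hφ =>
  mem_nagata_inf hDA hA hres hV (mem_krNagata.1 hφ).2 ((mem_krNagata.1 hφ).1 V hV)

end Semilocal

/-! ### Nagata rings of localizations. -/

section NagataLocalization

variable {K : Type*} [Field K]

local notation "ι" => algebraMap (Polynomial K) (RatFunc K)

theorem polyHom_injective (B : Subring K) : Function.Injective (polyHom B) :=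
  (RatFunc.algebraMap_injective K).comp (Polynomial.map_injective B.subtype Subtype.val_injective)

theorem le_localizationAt {L : Type*} [Field L] (B : Subring L) (P : Ideal B) [P.IsPrime] :
    B ≤ localizationAt B P :=
  LocalSubring.le_ofPrime B P

theorem notMem_map_C_of_contentIdeal {R : Type*} [CommRing R] {N : Ideal R} (hN : N ≠ ⊤) {g : R[X]}
    (hg : g.contentIdeal = ⊤) : g ∉ N.map C := by
  intro h
  rw [Ideal.mem_map_C_iff] at h
  refine hN (top_le_iff.1 (hg ▸ ?_))
  rw [contentIdeal_def, Ideal.span_le]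
  intro x hx
  obtain ⟨n, -, rfl⟩ := mem_coeffs_iff.1 hx
  exact h n

theorem exists_map_eq_C_mul (S : Subring K) (N : Ideal S) [N.IsPrime]
    (f : (localizationAt S N)[X]) :
    ∃ s : S, s ∉ N ∧ ∃ F : S[X],
      F.map S.subtype = C (s : K) * f.map (localizationAt S N).subtype := by
  induction f using Polynomial.induction_on' with
  | add f g hf hg =>
    obtain ⟨s, hs, F, hF⟩ := hf
    obtain ⟨r, hr, G, hG⟩ := hg
    refine ⟨s * r, fun h => (Ideal.IsPrime.mem_or_mem ‹_› h).elim hs hr, C r * F + C s * G, ?_⟩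
    simp only [Polynomial.map_add, Polynomial.map_mul, map_C, hF, hG, Subring.subtype_apply,
      Subring.coe_mul, C_mul]
    ring
  | monomial n c =>
    obtain ⟨a, b, hb, hab⟩ := mem_localizationAt.1 c.2
    have hb0 : (b : K) ≠ 0 := fun h0 => hb (by
      rw [show b = 0 from Subtype.ext h0]; exact N.zero_mem)
    refine ⟨b, hb, monomial n a, ?_⟩
    rw [map_monomial, map_monomial, C_mul_monomial, Subring.subtype_apply, Subring.subtype_apply,
      hab, mul_div_cancel₀ _ hb0]

/-- The Nagata ring of the local ring `S_N` is the localization of `S[t]` at `N S[t]`. -/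
theorem mem_nagata_localizationAt {S : Subring K} {N : Ideal S} [hN : N.IsPrime] {φ : RatFunc K} :
    φ ∈ nagata (localizationAt S N) ↔
      ∃ F h : S[X], h ∉ N.map C ∧ φ = polyHom S F / polyHom S h := by
  constructor
  · rintro ⟨f, g, hg, rfl⟩
    obtain ⟨s, hs, F, hF⟩ := exists_map_eq_C_mul S N f
    obtain ⟨r, hr, G, hG⟩ := exists_map_eq_C_mul S N g
    have hs0 : (s : K) ≠ 0 := fun h0 => hs (by
      rw [show s = 0 from Subtype.ext h0]; exact N.zero_mem)
    have hr0 : (r : K) ≠ 0 := fun h0 => hr (by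
      rw [show r = 0 from Subtype.ext h0]; exact N.zero_mem)
    refine ⟨C r * F, C s * G, fun hmem => ?_, ?_⟩
    · have hprime : (N.map C : Ideal S[X]).IsPrime := Ideal.isPrime_map_C_of_isPrime
      rcases hprime.mem_or_mem hmem with h | h
      · exact hs (by simpa using Ideal.mem_map_C_iff.1 h 0)
      · obtain ⟨-, a, ⟨a, rfl⟩, m, hm⟩ := isUnimodular_map_iff.2 hg
        obtain ⟨q, hq, A', hA'⟩ := exists_map_eq_C_mul S N a
        -- After clearing denominators, the relation expressing that `g` has unit content reads `(A'
        -- * G).coeff m = q * r`, an element outside `N`.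
        have h1 := Ideal.mem_map_C_iff.1 (Ideal.mul_mem_left _ A' h) m
        have h2 : (A' * G).coeff m = q * r := by
          apply Subtype.ext
          have h3 : (A' * G).map S.subtype = C (q * r : K) *
              (a.map (localizationAt S N).subtype * g.map (localizationAt S N).subtype) := by
            rw [Polynomial.map_mul, hA', hG, C_mul]; ring
          have h4 := congrArg (fun p => coeff p m) h3
          simp only [coeff_map, coeff_C_mul] at h4
          rw [coe_mapRingHom] at hm
          rw [hm, mul_one] at h4
          exact h4
        rw [h2] at h1
        exact (hN.mem_or_mem h1).elim hq hr
    · simp only [polyHom, RingHom.comp_apply, coe_mapRingHom, Polynomial.map_mul, map_C, hF, hG,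
        Subring.subtype_apply]
      rw [← mul_assoc, ← mul_assoc, ← C_mul, ← C_mul, mul_comm (r : K), map_mul, map_mul ι (C _),
        mul_div_mul_left]
      exact algebraMap_poly_ne_zero (C_ne_zero.2 (mul_ne_zero hs0 hr0))
  · rintro ⟨F, h, hh, rfl⟩
    rw [Ideal.mem_map_C_iff] at hh
    push Not at hh
    obtain ⟨n, hn⟩ := hh
    have hn0 : (h.coeff n : K) ≠ 0 := fun h0 => hn (by
      rw [show h.coeff n = 0 from Subtype.ext h0]; exact N.zero_mem)
    have hinv : (h.coeff n : K)⁻¹ ∈ localizationAt S N :=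
      mem_localizationAt.2 ⟨1, h.coeff n, hn, by simp⟩
    have hmem : ∀ f : S[X], C (h.coeff n : K)⁻¹ * f.map S.subtype ∈
        coeffSubring (localizationAt S N) := fun f =>
      mul_mem (C_mem_coeffSubring.2 hinv) (coeffSubring_mono (le_localizationAt S N) ⟨f, rfl⟩)
    refine mem_nagata.2 ⟨_, hmem F, _, isUnimodular_of_coeff_eq_one (hmem h) (m := n) ?_, ?_⟩
    · rw [coeff_C_mul, coeff_map]
      exact inv_mul_cancel₀ hn0
    · rw [map_mul, map_mul, mul_div_mul_left]
      · rfl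
      · exact algebraMap_poly_ne_zero (C_ne_zero.2 (inv_ne_zero hn0))

theorem algebraMap_mem_of_coeff {T : Subring (RatFunc K)} (hX : ι X ∈ T) {f : K[X]}
    (hf : ∀ n, ι (C (f.coeff n)) ∈ T) : ι f ∈ T := by
  rw [f.as_sum_range_C_mul_X_pow, map_sum]
  refine sum_mem fun n _ => ?_
  rw [map_mul, map_pow]
  exact mul_mem (hf n) (pow_mem hX n)

/-- A criterion for a localization of a subring `R` of `S(t)` to be the Nagata ring of a
localization of `S`. -/
theorem localizationAt_eq_nagata {R : Subring (RatFunc K)} {S : Subring K} (hRS : R ≤ nagata S)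
    (hX : ι X ∈ R)
    (hinv : ∀ x ∈ S, ι 1 / ι (C x * X + 1) ∈ R ∧ ι (C x) / ι (C x * X + 1) ∈ R)
    (P : Ideal R) [hP : P.IsPrime] (N : Ideal S) [hN : N.IsPrime]
    (hPN : ∀ (f g : S[X]), g.contentIdeal = ⊤ → ∀ h : polyHom S f / polyHom S g ∈ R,
      (⟨_, h⟩ : R) ∈ P ↔ f ∈ N.map C) :
    localizationAt R P = nagata (localizationAt S N) := by
  have hprime : (N.map C : Ideal S[X]).IsPrime := Ideal.isPrime_map_C_of_isPrime
  have hne : ∀ f : S[X], f ∉ N.map C → polyHom S f ≠ 0 := fun f hf h0 => hf (by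
    rw [(map_eq_zero_iff _ (polyHom_injective S)).1 h0]; exact Ideal.zero_mem _)
  apply le_antisymm
  · intro x hx
    obtain ⟨⟨_, ha⟩, ⟨_, hb⟩, hbP, rfl⟩ := mem_localizationAt.1 hx
    obtain ⟨f, g, hg, rfl⟩ := hRS ha
    obtain ⟨f', g', hg', rfl⟩ := hRS hb
    rw [hPN f' g' hg' hb] at hbP
    refine mem_nagata_localizationAt.2 ⟨f * g', g * f', fun h => ?_, ?_⟩
    · exact (hprime.mem_or_mem h).elim (notMem_map_C_of_contentIdeal hN.ne_top hg) hbP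
    · rw [div_div_div_eq, map_mul, map_mul]
  · intro x hx
    obtain ⟨F, h, hh, rfl⟩ := mem_nagata_localizationAt.1 hx
    -- `x` is the quotient of `x / (1 + x t)` by `1 / (1 + x t)`; the latter is outside `P` because
    -- its numerator is `1`.
    have hC : ∀ x ∈ S, ι (C x) ∈ localizationAt R P := by
      intro x hx
      have hg : ((C ⟨x, hx⟩ : S[X]) * X + 1).contentIdeal = ⊤ :=
        contentIdeal_eq_top_of_coeff (n := 0) (by simp)
      have hg1 : polyHom S (C ⟨x, hx⟩ * X + 1) = ι (C x * X + 1) := by simp [polyHom]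
      have hmem : polyHom S 1 / polyHom S (C ⟨x, hx⟩ * X + 1) ∈ R := by
        rw [hg1]; simpa using (hinv x hx).1
      refine mem_localizationAt.2 ⟨⟨_, (hinv x hx).2⟩, ⟨_, hmem⟩, ?_, ?_⟩
      · rw [hPN _ _ hg]
        exact fun h => hprime.ne_top (Ideal.eq_top_of_isUnit_mem _ h isUnit_one)
      · have h0 := polyHom_ne_zero hg
        rw [hg1] at h0
        simp only [hg1, map_one]
        field_simp
    have hpoly : ∀ f : S[X], polyHom S f ∈ localizationAt R P := fun f =>
      algebraMap_mem_of_coeff (le_localizationAt R P hX) fun n => hC _ (by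
        rw [coe_mapRingHom, coeff_map]; exact (f.coeff n).2)
    rw [div_eq_mul_inv]
    refine mul_mem (hpoly F) ?_
    -- Write `h = a / b` with `b ∉ P`. The numerator of `a = h b` is a product of polynomials
    -- outside the prime `N S[t]`, so `a ∉ P` and `h` is inverted by `b / a`.
    obtain ⟨⟨a, ha⟩, ⟨_, hb⟩, hbP, hab⟩ := mem_localizationAt.1 (hpoly h)
    obtain ⟨f', g', hg', rfl⟩ := hRS hb
    rw [hPN f' g' hg' hb] at hbP
    have haeq : a = polyHom S (h * f') / polyHom S g' := by
      have h0 := hne _ hbP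
      have h1 := polyHom_ne_zero hg'
      rw [map_mul, hab]
      field_simp
    subst haeq
    refine mem_localizationAt.2 ⟨⟨_, hb⟩, ⟨_, ha⟩, ?_, ?_⟩
    · rw [hPN _ _ hg']
      exact fun h1 => (hprime.mem_or_mem h1).elim hh hbP
    · rw [hab, inv_div]

end NagataLocalization

/-! ### Localization of `R'` at the center of `V(t)`. -/

section Centers

variable {K : Type*} [Field K]

local notation "ι" => algebraMap (Polynomial K) (RatFunc K)

/-- The localization of `R'` at the center of `V(t)`. -/
theorem localizationAt_center_eq {D A : Subring K} (hDA : D ≤ A)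
    (hA : Finite (MaximalSpectrum (intClosure A)))
    (hres : ∀ M : Ideal D, M.IsMaximal →
      ((Nat.card (MaximalSpectrum (intClosure A)) + 1 : ℕ) : ℕ∞) ≤ ENat.card (D ⧸ M))
    (V : ValuationSubring K) (hV : D ≤ V.toSubring) :
    localizationAt (krNagata D A)
      (center (trivialExtension V) (krNagata D A) (krNagata_le A hV)) =
      nagata (localizationAt (A ⊓ V.toSubring) (center V (A ⊓ V.toSubring) inf_le_right)) := by
  refine localizationAt_eq_nagata (krNagata_le_nagata_inf hDA hA hres hV) (X_mem_krNagata D A)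
    (fun x hx => inv_mem_krNagata D hx.1) _ _ fun f g hg h => ?_
  have hg' := isUnimodular_map_iff.2 hg
  rw [mem_center]
  refine (valuation_trivialExtension_lt_one_iff V _ hg'.ne_zero).trans ?_
  rw [coe_mapRingHom, hg'.gauss_eq_one inf_le_right, gauss_lt_iff one_pos, Ideal.mem_map_C_iff]
  refine forall_congr' fun n => ?_
  rw [mem_center, coeff_map]
  rfl

/-- If `A` and `V` generate the field `K`, then the localization of `A ∩ V` at the center of `V` is
`V`. -/
theorem localizationAt_inf_eq {D A : Subring K} [IsFractionRing D K] (hDA : D ≤ A)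
    (hA : Finite (MaximalSpectrum (intClosure A)))
    (hres : ∀ M : Ideal D, M.IsMaximal →
      ((Nat.card (MaximalSpectrum (intClosure A)) + 1 : ℕ) : ℕ∞) ≤ ENat.card (D ⧸ M))
    (V : ValuationSubring K) (hV : D ≤ V.toSubring)
    (hAV : ∀ B : Subring K, A ≤ B → V.toSubring ≤ B → B = ⊤) :
    localizationAt (A ⊓ V.toSubring) (center V (A ⊓ V.toSubring) inf_le_right) =
      V.toSubring := by
  -- The elements dominated in value by some element of `A` form a ring containing `A` and `V`,
  -- hence all of `K`.
  have hlarge : ∀ x : K, ∃ a ∈ A, V.valuation x ≤ V.valuation a := by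
    let B : Subring K :=
      { carrier := {x | ∃ a ∈ A, V.valuation x ≤ V.valuation a}
        mul_mem' := by
          rintro x y ⟨a, ha, hxa⟩ ⟨b, hb, hyb⟩
          exact ⟨a * b, mul_mem ha hb, by rw [map_mul, map_mul]; exact mul_le_mul' hxa hyb⟩
        one_mem' := ⟨1, A.one_mem, le_rfl⟩
        add_mem' := by
          rintro x y ⟨a, ha, hxa⟩ ⟨b, hb, hyb⟩
          rcases le_total (V.valuation a) (V.valuation b) with h | h
          · exact ⟨b, hb, (Valuation.map_add _ _ _).trans (max_le (hxa.trans h) hyb)⟩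
          · exact ⟨a, ha, (Valuation.map_add _ _ _).trans (max_le hxa (hyb.trans h))⟩
        zero_mem' := ⟨0, A.zero_mem, le_rfl⟩
        neg_mem' := by
          rintro x ⟨a, ha, hxa⟩
          exact ⟨a, ha, by rwa [Valuation.map_neg]⟩ }
    have hB : B = ⊤ := hAV B (fun a ha => ⟨a, ha, le_rfl⟩)
      fun x hx => ⟨1, A.one_mem, by rw [map_one]; exact (V.valuation_le_one_iff x).2 hx⟩
    intro x
    have hx : x ∈ B := hB ▸ Subring.mem_top x
    exact hx
  apply le_antisymm
  · intro x hx
    obtain ⟨a, b, hb, rfl⟩ := mem_localizationAt.1 hx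
    rw [mem_center, not_lt] at hb
    refine (V.valuation_le_one_iff _).1 ?_
    rw [map_div₀]
    exact div_le_one_of_le₀ (((V.valuation_le_one_iff _).2 a.2.2).trans hb) zero_le
  · intro x hx
    obtain ⟨c, e, he, rfl⟩ := IsFractionRing.div_surjective (A := D) x
    have he0 : (e : K) ≠ 0 := fun h0 => nonZeroDivisors.ne_zero he (Subtype.ext h0)
    -- For `x = c / e`, the element `z = e a` of `A` has value at least `1`. A unit combination `y`
    -- for `1 + z t` has the same value as `z`, so `b = z / y` lies in `A` with value `1`, and `x b
    -- = c a / y` lies in `A ∩ V`.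
    obtain ⟨a, ha, hea⟩ := hlarge (e : K)⁻¹
    have hz : 1 ≤ V.valuation (e * a) := by
      rw [map_mul, ← mul_inv_cancel₀ ((V.valuation.ne_zero_iff).2 he0), ← map_inv₀]
      exact mul_le_mul_right hea _
    have hzA : (e * a : K) ∈ A := mul_mem (hDA e.2) ha
    obtain ⟨-, -, y, -, hyA, hyA', hyV⟩ :=
      exists_combination_unit hDA hA hres hV (C_mul_X_add_one_isUnimodular hzA)
    rw [gauss_C_mul_X_add_one, max_eq_right hz] at hyV
    have hy0 : V.valuation y ≠ 0 := by
      rw [hyV]; exact (zero_lt_one.trans_le hz).ne'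
    have hb : V.valuation (e * a * y⁻¹) = 1 := by
      rw [map_mul, map_inv₀, ← hyV, mul_inv_cancel₀ hy0]
    have hb0 : (e * a * y⁻¹ : K) ≠ 0 := fun h0 => by
      rw [h0, map_zero] at hb; exact zero_ne_one hb
    have hbA : (e * a * y⁻¹ : K) ∈ A := mul_mem hzA hyA'
    change (c / e : K) ∈ V at hx
    change (c / e : K) ∈ _
    refine mem_localizationAt.2 ⟨⟨c / e * (e * a * y⁻¹), ?_, ?_⟩,
      ⟨e * a * y⁻¹, hbA, (V.valuation_le_one_iff _).1 hb.le⟩, ?_, ?_⟩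
    · have : (c / e * (e * a * y⁻¹) : K) = c * a * y⁻¹ := by field_simp
      rw [this]
      exact mul_mem (mul_mem (hDA c.2) ha) hyA'
    · exact mul_mem hx ((V.valuation_le_one_iff _).1 hb.le)
    · rw [mem_center, not_lt]
      exact hb.ge
    · rw [mul_div_cancel_right₀ _ hb0]

end Centers

/-! ### Compactness of the space of valuation rings. -/

section Compactness

variable {K : Type*} [Field K]

/-- The limit of a family of valuation rings along an ultrafilter. -/
def ultralimit {α : Type*} (F : Ultrafilter α) (U : α → ValuationSubring K) :
    ValuationSubring K where
  carrier := {x | ∀ᶠ i in (F : Filter α), x ∈ U i}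
  mul_mem' ha hb := by
    filter_upwards [ha, hb] with i hai hbi using mul_mem hai hbi
  one_mem' := Filter.Eventually.of_forall fun i => one_mem _
  add_mem' ha hb := by
    filter_upwards [ha, hb] with i hai hbi using add_mem hai hbi
  zero_mem' := Filter.Eventually.of_forall fun i => zero_mem _
  neg_mem' ha := by
    filter_upwards [ha] with i hai using neg_mem hai
  mem_or_inv_mem' x :=
    Ultrafilter.eventually_or.1 (Filter.Eventually.of_forall fun i => (U i).mem_or_inv_mem x)

theorem eventually_mem_coeffSubring {α : Type*} {F : Ultrafilter α} {U : α → ValuationSubring K}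
    {f : K[X]} (hf : f ∈ coeffSubring (ultralimit F U).toSubring) :
    ∀ᶠ i in (F : Filter α), f ∈ coeffSubring (U i).toSubring := by
  have h : ∀ᶠ i in (F : Filter α), ∀ n ∈ f.support, f.coeff n ∈ U i :=
    (Filter.eventually_all_finset f.support).2 fun n _ => mem_coeffSubring.1 hf n
  filter_upwards [h] with i hi
  refine mem_coeffSubring.2 fun n => ?_
  by_cases hn : n ∈ f.support
  · exact hi n hn
  · rw [notMem_support_iff.1 hn]
    exact zero_mem _

/-- Unimodularity is witnessed by one multiplier `a`, so it involves only finitely many membership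
conditions, and these pass from the limit to almost all `U i`. -/
theorem eventually_isUnimodular {α : Type*} {F : Ultrafilter α} {U : α → ValuationSubring K}
    {g : K[X]} (hg : IsUnimodular (ultralimit F U).toSubring g) :
    ∀ᶠ i in (F : Filter α), IsUnimodular (U i).toSubring g := by
  obtain ⟨hg, a, ha, m, hm⟩ := hg
  filter_upwards [eventually_mem_coeffSubring hg, eventually_mem_coeffSubring ha] with i h1 h2
  exact ⟨h1, a, h2, m, hm⟩

/-- A compactness property of the space of valuation rings that contain `D`. -/
theorem exists_finset_forall_gauss_le (D : Subring K) (Φ : Set (K[X] × K[X]))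
    (hΦ : ∀ V : ValuationSubring K, D ≤ V.toSubring →
      ∃ p ∈ Φ, IsUnimodular V.toSubring p.1 ∧ IsUnimodular V.toSubring p.2) :
    ∃ T : Finset Φ, ∀ V : ValuationSubring K, D ≤ V.toSubring →
      ∃ p ∈ T, gauss V.valuation p.1.2 ≤ gauss V.valuation p.1.1 := by
  classical
  by_contra! hcon
  -- Each finite `T` gets a counterexample `U T`. An ultrafilter refining `atTop` makes every fixed
  -- pair belong to almost all `T`, while in the limit ring some pair has both Gauss norms equal to
  -- `1`.
  choose U hUD hU using hcon
  let F : Ultrafilter (Finset Φ) := Ultrafilter.of Filter.atTop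
  obtain ⟨p, hp, h1, h2⟩ := hΦ (ultralimit F U) fun x hx =>
    Filter.Eventually.of_forall fun T => hUD T hx
  have hT : ∀ᶠ T in (F : Filter (Finset Φ)), {⟨p, hp⟩} ≤ T :=
    Ultrafilter.of_le _ (Filter.eventually_ge_atTop _)
  obtain ⟨T, hT, h1, h2⟩ :=
    (hT.and ((eventually_isUnimodular h1).and (eventually_isUnimodular h2))).exists
  have h := hU T ⟨p, hp⟩ (hT (Finset.mem_singleton_self _))
  rw [h1.gauss_eq_one le_rfl, h2.gauss_eq_one le_rfl] at h
  exact h.false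

end Compactness

/-! ### Valuation rings above `R'` and maximal ideals of `R'`. -/

section Overrings

variable {K : Type*} [Field K]

local notation "ι" => algebraMap (Polynomial K) (RatFunc K)

/-- Finitely many fractions `p.2 / p.1` of unimodular polynomials that do not belong to `W` are
dominated by a single one. -/
theorem exists_dominating_fraction {A : Subring K} {W : ValuationSubring (RatFunc K)}
    (hX : ι X ∈ W) {Φ : Set (K[X] × K[X])}
    (hΦ : ∀ p ∈ Φ, IsUnimodular A p.1 ∧ IsUnimodular A p.2 ∧
      W.valuation (ι p.1) < W.valuation (ι p.2)) (T : Finset Φ) (hT : T.Nonempty) :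
    ∃ G H : K[X], IsUnimodular A G ∧ IsUnimodular A H ∧
      W.valuation (ι G) < W.valuation (ι H) ∧
      ∀ V : ValuationSubring K, (∃ p ∈ T, gauss V.valuation p.1.2 ≤ gauss V.valuation p.1.1) →
        gauss V.valuation H ≤ gauss V.valuation G := by
  induction hT using Finset.Nonempty.cons_induction with
  | singleton p =>
    obtain ⟨h1, h2, h3⟩ := hΦ p.1 p.2
    exact ⟨p.1.1, p.1.2, h1, h2, h3, fun V ⟨q, hq, h⟩ => by rwa [Finset.mem_singleton.1 hq] at h⟩
  | cons p T hp hT ih =>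
    obtain ⟨G, H, hG, hH, hlt, hGH⟩ := ih
    obtain ⟨h1, h2, h3⟩ := hΦ p.1 p.2
    obtain ⟨N, hN⟩ := IsUnimodular.exists_add_X_pow_mul (hG.mul h2).1 (h1.mul hH)
    set n := max N ((G * p.1.2).natDegree + 1) with hn
    have hWX : W.valuation (ι X) ≤ 1 := (W.valuation_le_one_iff _).2 hX
    have hWpos : ∀ {f : K[X]}, f ≠ 0 → 0 < W.valuation (ι f) := fun hf =>
      zero_lt_iff.2 ((W.valuation.ne_zero_iff).2 (algebraMap_poly_ne_zero hf))
    -- The new `G / H` is the old one plus `X ^ n` times `p.1 / p.2`. For large `n` its numerator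
    -- has as Gauss norm the maximum of those of the two summands, so one good inequality suffices;
    -- both summands have `W`-value below `1`.
    refine ⟨G * p.1.2 + X ^ n * (p.1.1 * H), H * p.1.2, hN n (le_max_left _ _), hH.mul h2,
      ?_, fun V hV => ?_⟩
    · simp only [map_add, map_mul, map_pow]
      refine (Valuation.map_add _ _ _).trans_lt (max_lt ?_ ?_)
      · rw [map_mul]
        exact mul_lt_mul_of_pos_right hlt (hWpos h2.ne_zero)
      · rw [map_mul, map_mul, map_pow, mul_comm (W.valuation (ι H))]
        exact (mul_le_of_le_one_left' (pow_le_one' hWX n)).trans_lt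
          (mul_lt_mul_of_pos_right h3 (hWpos hH.ne_zero))
    · rw [gauss_add_X_pow_mul _ _ (lt_of_lt_of_le (Nat.lt_succ_self _) (le_max_right _ _)),
        gauss_mul, gauss_mul, gauss_mul]
      obtain ⟨q, hq, hle⟩ := hV
      rcases Finset.mem_cons.1 hq with rfl | hq
      · refine le_max_of_le_right ?_
        rw [mul_comm]
        exact mul_le_mul_left hle _
      · refine le_max_of_le_left ?_
        exact mul_le_mul_left (hGH V ⟨q, hq, hle⟩) _

/-- Every valuation ring containing `R'` contains `(A ∩ V)(t)` for some valuation ring `V ⊇ D`. -/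
theorem exists_nagata_inf_le {D A : Subring K} (W : ValuationSubring (RatFunc K))
    (hW : krNagata D A ≤ W.toSubring) :
    ∃ V : ValuationSubring K, D ≤ V.toSubring ∧ nagata (A ⊓ V.toSubring) ≤ W.toSubring := by
  by_contra! hcon
  have hX : ι X ∈ W := hW (X_mem_krNagata D A)
  have hWX : W.valuation (ι X) ≤ 1 := (W.valuation_le_one_iff _).2 hX
  let Φ : Set (K[X] × K[X]) := {p | IsUnimodular A p.1 ∧ IsUnimodular A p.2 ∧
    W.valuation (ι p.1) < W.valuation (ι p.2)}
  obtain ⟨T, hT⟩ := exists_finset_forall_gauss_le D Φ fun V hV => by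
    obtain ⟨φ, hφ, hφW⟩ := SetLike.not_le_iff_exists.1 (hcon V hV)
    obtain ⟨f, hf, g, hg, rfl⟩ := mem_nagata.1 hφ
    obtain ⟨N, hN⟩ := IsUnimodular.exists_add_X_pow_mul hf hg
    have hlt : W.valuation (ι g) < W.valuation (ι f) := by
      have h1 : ¬ W.valuation (ι f / ι g) ≤ 1 := fun h => hφW ((W.valuation_le_one_iff _).1 h)
      have h0 : 0 < W.valuation (ι g) :=
        zero_lt_iff.2 ((W.valuation.ne_zero_iff).2 (algebraMap_poly_ne_zero hg.ne_zero))
      rwa [not_le, map_div₀, one_lt_div₀ h0] at h1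
    -- Adding `X ^ N * g` makes the numerator unimodular without changing its `W`-value, since the
    -- `W`-value of `g` is smaller.
    have hval : W.valuation (ι (f + X ^ N * g)) = W.valuation (ι f) := by
      rw [map_add]
      refine Valuation.map_add_eq_of_lt_left _ ?_
      rw [map_mul, map_mul, map_pow, map_pow]
      exact (mul_le_of_le_one_left' (pow_le_one' hWX N)).trans_lt hlt
    refine ⟨(g, f + X ^ N * g), ⟨hg.mono inf_le_left, (hN N le_rfl).mono inf_le_left, ?_⟩,
      hg.mono inf_le_right, (hN N le_rfl).mono inf_le_right⟩
    rw [hval]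
    exact hlt
  have hne : T.Nonempty := by
    obtain ⟨p, hp, -⟩ := hT ⊤ fun _ _ => trivial
    exact ⟨p, hp⟩
  obtain ⟨G, H, hG, hH, hlt, hGH⟩ := exists_dominating_fraction hX (fun p hp => hp) T hne
  have hmem := hW (div_mem_krNagata hH.1 hG fun V hV => hGH V (hT V hV))
  have h1 := (W.valuation_le_one_iff _).2 hmem
  rw [map_div₀, div_le_one₀ (zero_lt_iff.2
    ((W.valuation.ne_zero_iff).2 (algebraMap_poly_ne_zero hG.ne_zero)))] at h1
  exact absurd hlt (not_lt.2 h1)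

/-- The localizations of `R'` at maximal ideals are Nagata rings of overrings of `D`. -/
theorem exists_localizationAt_eq_nagata {D A : Subring K} (hDA : D ≤ A)
    (hA : Finite (MaximalSpectrum (intClosure A)))
    (hres : ∀ M : Ideal D, M.IsMaximal →
      ((Nat.card (MaximalSpectrum (intClosure A)) + 1 : ℕ) : ℕ∞) ≤ ENat.card (D ⧸ M))
    (M : Ideal (krNagata D A)) [hM : M.IsMaximal] :
    ∃ C : Subring K, D ≤ C ∧ localizationAt (krNagata D A) M = nagata C := by
  obtain ⟨W, hW, hWM⟩ := exists_valuationSubring_forall_mem_iff (krNagata D A) M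
  obtain ⟨V, hV, hVW⟩ := exists_nagata_inf_le W hW
  set S := A ⊓ V.toSubring with hS
  have hpoly : ∀ f : S[X], W.valuation (polyHom S f) ≤ 1 := fun f =>
    (W.valuation_le_one_iff _).2 (hVW (algebraMap_mem_nagata ⟨f, rfl⟩))
  have hunit : ∀ g : S[X], g.contentIdeal = ⊤ → W.valuation (polyHom S g) = 1 := fun g hg => by
    refine le_antisymm (hpoly g) ?_
    have h := (W.valuation_le_one_iff _).2
      (hVW (inv_algebraMap_mem_nagata (isUnimodular_map_iff.2 hg)))
    rw [map_inv₀] at h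
    exact (inv_le_one₀ (zero_lt_iff.2 ((W.valuation.ne_zero_iff).2 (polyHom_ne_zero hg)))).1 h
  -- the coefficients of the polynomials over `S` in the center of `W`
  let I : Ideal S :=
    { carrier := {c | ∃ f : S[X], W.valuation (polyHom S f) < 1 ∧ ∃ m, f.coeff m = c}
      add_mem' := by
        rintro _ _ ⟨f, hf, m, rfl⟩ ⟨g, hg, k, rfl⟩
        -- The shifts bring the two chosen coefficients into the common degree `m + k`.
        refine ⟨f * X ^ k + g * X ^ m, ?_, m + k, ?_⟩
        · rw [map_add, map_mul, map_mul]
          refine (Valuation.map_add _ _ _).trans_lt (max_lt ?_ ?_) <;> rw [map_mul]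
          · exact (mul_le_of_le_one_right' (hpoly _)).trans_lt hf
          · exact (mul_le_of_le_one_right' (hpoly _)).trans_lt hg
        · rw [coeff_add, coeff_mul_X_pow, add_comm m k, coeff_mul_X_pow]
      zero_mem' := ⟨0, by rw [map_zero, map_zero]; exact zero_lt_one, 0, rfl⟩
      smul_mem' := by
        rintro c _ ⟨f, hf, m, rfl⟩
        refine ⟨C c * f, ?_, m, by simp⟩
        rw [map_mul, map_mul]
        exact (mul_le_of_le_one_left' (hpoly _)).trans_lt hf }
  have hI : I ≠ ⊤ := by
    rw [Ne, Ideal.eq_top_iff_one]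
    rintro ⟨f, hf, m, hm⟩
    exact hf.ne (hunit f (contentIdeal_eq_top_of_coeff hm))
  obtain ⟨N, hN, hIN⟩ := I.exists_le_maximal hI
  have hcenter : ∀ f : S[X], W.valuation (polyHom S f) < 1 → f ∈ N.map C := fun f hf =>
    Ideal.mem_map_C_iff.2 fun n => hIN ⟨f, hf, n, rfl⟩
  have hRS : krNagata D A ≤ nagata S := krNagata_le_nagata_inf hDA hA hres hV
  refine ⟨localizationAt S N, (le_inf hDA hV).trans (le_localizationAt S N),
    localizationAt_eq_nagata hRS (X_mem_krNagata D A) (fun x hx => inv_mem_krNagata D hx.1) M N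
    fun f g hg h => ⟨fun hfM => hcenter f ?_, fun hf => ?_⟩⟩
  · have h1 := (hWM _).1 hfM
    rwa [map_div₀, hunit g hg, div_one] at h1
  · by_contra hfM
    -- Otherwise `f / g` is invertible modulo `M`; clearing denominators in that relation puts a
    -- product of polynomials of unit content into `N S[t]`.
    obtain ⟨⟨_, ha⟩, m, hm, hsum⟩ := hM.exists_inv hfM
    obtain ⟨m, hmR⟩ := m
    obtain ⟨f₁, g₁, hg₁, rfl⟩ := hRS ha
    obtain ⟨f₂, g₂, hg₂, rfl⟩ := hRS hmR
    have hf₂ : f₂ ∈ N.map C := by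
      refine hcenter f₂ ?_
      have h1 := (hWM _).1 hm
      rwa [map_div₀, hunit g₂ hg₂, div_one] at h1
    have hsum : polyHom S f₁ / polyHom S g₁ * (polyHom S f / polyHom S g) +
        polyHom S f₂ / polyHom S g₂ = 1 := congrArg Subtype.val hsum
    have hg0 := polyHom_ne_zero hg
    have hg₁0 := polyHom_ne_zero hg₁
    have hg₂0 := polyHom_ne_zero hg₂
    have heq : g * g₁ * g₂ = f₁ * g₂ * f + g₁ * g * f₂ := by
      apply polyHom_injective S
      simp only [map_add, map_mul]
      rw [div_mul_div_comm, div_add_div _ _ (mul_ne_zero hg₁0 hg0) hg₂0,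
        div_eq_one_iff_eq (mul_ne_zero (mul_ne_zero hg₁0 hg0) hg₂0)] at hsum
      linear_combination -hsum
    refine notMem_map_C_of_contentIdeal hN.ne_top (contentIdeal_mul_eq_top_of_contentIdeal_eq_top
      (contentIdeal_mul_eq_top_of_contentIdeal_eq_top hg hg₁) hg₂) ?_
    rw [heq]
    exact add_mem (Ideal.mul_mem_left _ _ hf) (Ideal.mul_mem_left _ _ hf₂)

end Overrings

/-! ### Norms of polynomials as resultants. -/

section Norm

open Polynomial.Bivariate

/-- The norm of a polynomial `G ∈ R[x][t]` modulo a monic polynomial `h ∈ R[x]`, as a resultant. -/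
noncomputable def polyNorm {R : Type*} [CommRing R] (h : R[X]) (G : R[X][X]) : R[X] :=
  resultant (h.map C) (swap G) h.natDegree (swap G).natDegree

theorem map_polyNorm {R F : Type*} [CommRing R] [Field F] [IsAlgClosed F] (ψ : R →+* F) {h : R[X]}
    (hh : h.Monic) (G : R[X][X]) :
    (polyNorm h G).map ψ =
      ((h.map ψ).roots.map fun σ => G.map (eval₂RingHom ψ σ)).prod := by
  have hmap : (h.map C).map (mapRingHom ψ) = (h.map ψ).map C := by
    rw [Polynomial.map_map, Polynomial.map_map, mapRingHom_comp_C]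
  have hdeg : ((h.map ψ).map (C : F →+* F[X])).natDegree = h.natDegree := by
    rw [natDegree_map_eq_of_injective C_injective, hh.natDegree_map]
  have heval : ∀ σ : F, eval (C σ) ((swap G).map (mapRingHom ψ)) =
      G.map (eval₂RingHom ψ σ) := by
    intro σ
    induction G using Polynomial.induction_on' with
    | add p q hp hq => simp only [map_add, Polynomial.map_add, eval_add, hp, hq]
    | monomial n f =>
      rw [Bivariate.swap_monomial, Polynomial.map_mul, eval_mul, Polynomial.map_map, map_C, eval_C,
        mapRingHom_comp_C, ← Polynomial.map_map, eval_map_apply, map_monomial, eval_map]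
      simp [C_mul_X_pow_eq_monomial]
  have hsplit : (h.map ψ).Splits := IsAlgClosed.splits _
  -- The formal degree of `swap G` is kept, since its actual degree may drop under `ψ`; the
  -- resultant then commutes with `ψ`, and as `h` is monic no leading coefficient appears.
  have hres := resultant_eq_prod_eval ((h.map ψ).map C) ((swap G).map (mapRingHom ψ))
    (swap G).natDegree natDegree_map_le (hsplit.map C)
  rw [hdeg, ((hh.map ψ).map C).leadingCoeff, one_pow, one_mul, hsplit.roots_map,
    Multiset.map_map] at hres
  rw [← coe_mapRingHom, polyNorm, ← resultant_map_map, hmap, hres]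
  congr 1
  exact Multiset.map_congr rfl fun σ _ => heval σ

/-- Over an algebraic closure of any residue field the norm is a product of specializations of `G`.
Each keeps the coefficient `1`, so the product is nonzero and no maximal ideal contains the content.
-/
theorem contentIdeal_polyNorm {R : Type*} [CommRing R] {h : R[X]} (hh : h.Monic) {G : R[X][X]}
    {m : ℕ} (hG : G.coeff m = 1) : (polyNorm h G).contentIdeal = ⊤ := by
  by_contra hcon
  obtain ⟨n, hn, hle⟩ := Ideal.exists_le_maximal _ hcon
  let := Ideal.Quotient.field n
  let ψ : R →+* AlgebraicClosure (R ⧸ n) :=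
    (algebraMap (R ⧸ n) (AlgebraicClosure (R ⧸ n))).comp (Ideal.Quotient.mk n)
  have h0 : (polyNorm h G).map ψ = 0 := by
    ext k
    have : Ideal.Quotient.mk n ((polyNorm h G).coeff k) = 0 :=
      Ideal.Quotient.eq_zero_iff_mem.2 (hle (coeff_mem_contentIdeal _ k))
    rw [coeff_map, RingHom.comp_apply, this, map_zero, coeff_zero]
  rw [map_polyNorm ψ hh, Multiset.prod_eq_zero_iff] at h0
  obtain ⟨σ, -, hσ⟩ := Multiset.mem_map.1 h0
  have h1 := congrArg (fun p => coeff p m) hσ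
  simp [coeff_map, hG] at h1

/-- Over an algebraic closure `x` is one of the roots of `h`, so its specialization of `G` is a
factor of the norm; divisibility descends to `K`. -/
theorem map_eval₂_dvd_polyNorm {R K : Type*} [CommRing R] [Field K] (ψ : R →+* K) {h : R[X]}
    (hh : h.Monic) {x : K} (hx : h.eval₂ ψ x = 0) (G : R[X][X]) :
    G.map (eval₂RingHom ψ x) ∣ (polyNorm h G).map ψ := by
  let j := algebraMap K (AlgebraicClosure K)
  rw [← Polynomial.map_dvd_map' j, Polynomial.map_map, Polynomial.map_map,
    map_polyNorm (j.comp ψ) hh]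
  have hj : j.comp (eval₂RingHom ψ x) = eval₂RingHom (j.comp ψ) (j x) := by
    ext <;> simp
  rw [hj]
  refine Multiset.dvd_prod (Multiset.mem_map.2 ⟨j x, ?_, rfl⟩)
  rw [mem_roots (hh.map _).ne_zero, IsRoot, eval_map, ← hom_eval₂, hx, map_zero]

end Norm

/-! ### Unimodular polynomials over the integral closure. -/

section IntegralClosure

variable {L : Type*} [Field L]

theorem mem_intClosure {B : Subring L} {x : L} :
    x ∈ intClosure B ↔ ∃ p ∈ coeffSubring B, p.Monic ∧ p.eval x = 0 := by
  constructor
  · rintro ⟨p, hp, hx⟩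
    exact ⟨p.map B.subtype, ⟨p, rfl⟩, hp.map _, by rw [eval_map]; exact hx⟩
  · rintro ⟨_, ⟨p, rfl⟩, hp, hx⟩
    rw [coe_mapRingHom] at hp hx
    exact ⟨p, monic_of_injective Subtype.val_injective hp, by rw [eval_map] at hx; exact hx⟩

theorem intClosure_mono {A B : Subring L} (h : A ≤ B) : intClosure A ≤ intClosure B := fun x hx => by
  obtain ⟨p, hp, hpx⟩ := mem_intClosure.1 hx
  exact mem_intClosure.2 ⟨p, coeffSubring_mono h hp, hpx⟩

theorem mem_intClosure_iff_forall {B : Subring L} {x : L} :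
    x ∈ intClosure B ↔ ∀ V : ValuationSubring L, B ≤ V.toSubring → x ∈ V := by
  refine ⟨fun h V hV => intClosure_le hV h, fun h => ?_⟩
  by_contra hx
  obtain ⟨V, hV, hxV⟩ :=
    Subring.exists_le_valuationSubring_of_isIntegrallyClosedIn (R := (integralClosure B L).toSubring)
      hx
  exact hxV (h V ((le_intClosure B).trans hV))

/-- A unimodular polynomial over `B[x]`, where `x` is integral over `B`, divides a unimodular
polynomial over `B`. -/
theorem exists_isUnimodular_dvd_of_adjoin {B : Subring L} {x : L} (hx : x ∈ intClosure B) {g : L[X]}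
    (hg : IsUnimodular (Algebra.adjoin B {x}).toSubring g) :
    ∃ N, IsUnimodular B N ∧ g ∣ N := by
  classical
  obtain ⟨hgB, a, ha, m, hm⟩ := hg
  obtain ⟨h, hh, hhx⟩ := hx
  have hmem : ∀ n, ∃ p : B[X], aeval x p = (a * g).coeff n := fun n => by
    have h1 := mem_coeffSubring.1 (mul_mem ha hgB) n
    rw [Subalgebra.mem_toSubring, Algebra.adjoin_singleton_eq_range_aeval] at h1
    exact h1
  choose p hp using hmem
  -- The coefficient `1` of `a * g` is lifted to exactly `1`, as needed for the norm to have unit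
  -- content.
  let q : ℕ → B[X] := fun n => if n = m then 1 else p n
  have hq : ∀ n, aeval x (q n) = (a * g).coeff n := fun n => by
    by_cases hn : n = m
    · rw [hn, hm]
      simp [q]
    · simp only [q, if_neg hn, hp]
  let G : B[X][X] := ∑ n ∈ Finset.range ((a * g).natDegree + 1), monomial n (q n)
  have hGcoeff : ∀ n ≤ (a * g).natDegree, G.coeff n = q n := fun n hn => by
    simp only [G, finsetSum_coeff, coeff_monomial]
    rw [Finset.sum_ite_eq', if_pos (Finset.mem_range.2 (Nat.lt_succ_of_le hn))]
  have hGm : G.coeff m = 1 := by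
    rw [hGcoeff m (le_natDegree_of_ne_zero (by rw [hm]; exact one_ne_zero))]
    simp [q]
  have hGx : G.map (eval₂RingHom B.subtype x) = a * g := by
    conv_rhs => rw [(a * g).as_sum_range]
    simp only [G, Polynomial.map_sum, map_monomial]
    exact Finset.sum_congr rfl fun n _ => congrArg _ (hq n)
  refine ⟨(polyNorm h G).map B.subtype, isUnimodular_map_iff.2 (contentIdeal_polyNorm hh hGm),
    (Dvd.intro_left a rfl).trans ?_⟩
  rw [← hGx]
  exact map_eval₂_dvd_polyNorm B.subtype hh hhx G

/-- Adjoining the elements of `s` one at a time composes the divisibilities for simple extensions.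
It is applied to the finitely many coefficients of a polynomial and of its multiplier. -/
theorem exists_le_forall_isUnimodular_dvd (B : Subring L) (s : Finset L)
    (hs : ∀ x ∈ s, x ∈ intClosure B) :
    ∃ B' : Subring L, B ≤ B' ∧ (∀ x ∈ s, x ∈ B') ∧
      ∀ g, IsUnimodular B' g → ∃ N, IsUnimodular B N ∧ g ∣ N := by
  classical
  induction s using Finset.induction_on with
  | empty => exact ⟨B, le_rfl, by simp, fun g hg => ⟨g, hg, dvd_rfl⟩⟩
  | insert x s _ ih =>
    rw [Finset.forall_mem_insert] at hs
    obtain ⟨B', hBB', hsB', hB'⟩ := ih hs.2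
    have hle : B' ≤ (Algebra.adjoin B' {x}).toSubring := fun y hy =>
      (Algebra.adjoin B' {x}).algebraMap_mem ⟨y, hy⟩
    refine ⟨(Algebra.adjoin B' {x}).toSubring, hBB'.trans hle,
      Finset.forall_mem_insert _ _ _ |>.2 ⟨Algebra.self_mem_adjoin_singleton _ _,
        fun y hy => hle (hsB' y hy)⟩, fun g hg => ?_⟩
    obtain ⟨N, hN, hgN⟩ := exists_isUnimodular_dvd_of_adjoin (intClosure_mono hBB' hs.1) hg
    obtain ⟨N', hN', hNN'⟩ := hB' N hN
    exact ⟨N', hN', hgN.trans hNN'⟩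

theorem IsUnimodular.exists_dvd_of_intClosure {B : Subring L} {g : L[X]}
    (hg : IsUnimodular (intClosure B) g) : ∃ N, IsUnimodular B N ∧ g ∣ N := by
  classical
  obtain ⟨hgB, a, ha, m, hm⟩ := hg
  obtain ⟨B', -, hs, hB'⟩ := exists_le_forall_isUnimodular_dvd B (g.coeffs ∪ a.coeffs) fun x hx => by
    rcases Finset.mem_union.1 hx with h | h <;> obtain ⟨n, -, rfl⟩ := mem_coeffs_iff.1 h
    exacts [mem_coeffSubring.1 hgB n, mem_coeffSubring.1 ha n]
  have hcoeffs : ∀ f : L[X], f.coeffs ⊆ g.coeffs ∪ a.coeffs → f ∈ coeffSubring B' := fun f hf =>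
    mem_coeffSubring.2 fun n => by
      by_cases hn : f.coeff n = 0
      · rw [hn]; exact B'.zero_mem
      · exact hs _ (hf (coeff_mem_coeffs hn))
  exact hB' g ⟨hcoeffs g Finset.subset_union_left, a, hcoeffs a Finset.subset_union_right, m, hm⟩

end IntegralClosure

/-! ### The integral closure of `R'`. -/

section NagataIntegralClosure

variable {K : Type*} [Field K]

local notation "ι" => algebraMap (Polynomial K) (RatFunc K)

theorem valuation_algebraMap_le_gauss {Γ : Type*} [LinearOrderedCommGroupWithZero Γ]
    (w : Valuation (RatFunc K) Γ) (hX : w (ι X) ≤ 1) (f : K[X]) :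
    w (ι f) ≤ gauss (w.comap ((ι).comp C)) f := by
  conv_lhs => rw [f.as_sum_range_C_mul_X_pow, map_sum]
  refine w.map_sum_le fun n _ => ?_
  rw [map_mul, map_pow, map_mul, map_pow]
  exact (mul_le_of_le_one_right' (pow_le_one' hX n)).trans
    (le_gauss (w.comap ((ι).comp C)) f n)

/-- A valuation ring that contains `R'` induces the Gauss norm on the polynomials that are
unimodular over the integral closure of `A`. -/
theorem gauss_le_valuation {D A : Subring K} {W : ValuationSubring (RatFunc K)}
    (hW : krNagata D A ≤ W.toSubring) {g : K[X]} (hg : IsUnimodular (intClosure A) g) :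
    gauss (W.valuation.comap ((ι).comp C)) g ≤ W.valuation (ι g) := by
  have hX : W.valuation (ι X) ≤ 1 := (W.valuation_le_one_iff _).2 (hW (X_mem_krNagata D A))
  obtain ⟨N, hN, q, rfl⟩ := hg.exists_dvd_of_intClosure
  set v := W.valuation.comap ((ι).comp C) with hv
  have hq0 : q ≠ 0 := right_ne_zero_of_mul hN.ne_zero
  have hle : gauss v (g * q) ≤ W.valuation (ι (g * q)) := by
    refine gauss_le_iff.2 fun n => ?_
    -- Each coefficient of `N = g q` divided by `N` lies in `R'`, so `N` has at least its Gauss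
    -- value. The bound for `g` follows because `q` has at most its own.
    have hmem : ι (C ((g * q).coeff n)) / ι (g * q) ∈ krNagata D A :=
      div_mem_krNagata (C_mem_coeffSubring.2 (mem_coeffSubring.1 hN.1 n)) hN fun V _ => by
        rw [gauss_C]; exact le_gauss _ _ n
    have h1 := (W.valuation_le_one_iff _).2 (hW hmem)
    rwa [map_div₀, div_le_one₀ (zero_lt_iff.2
      ((W.valuation.ne_zero_iff).2 (algebraMap_poly_ne_zero hN.ne_zero)))] at h1
  rw [gauss_mul, map_mul, map_mul] at hle
  exact le_of_mul_le_mul_right (hle.trans (mul_le_mul_right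
    (valuation_algebraMap_le_gauss W.valuation hX q) _)) (gauss_pos v hq0)

theorem kronecker_inf_nagata_le {D A : Subring K} (hDA : D ≤ A) :
    kronecker (intClosure D) ⊓ nagata (intClosure A) ≤ intClosure (krNagata D A) := by
  rintro φ ⟨hφD, hφA⟩
  refine mem_intClosure_iff_forall.2 fun W hW => ?_
  obtain ⟨f, hf, g, hg, rfl⟩ := mem_nagata.1 hφA
  have hX : W.valuation (ι X) ≤ 1 := (W.valuation_le_one_iff _).2 (hW (X_mem_krNagata D A))
  set v := W.valuation.comap ((ι).comp C) with hv
  -- `V` is the restriction of `W` to `K`. Gauss norms are taken for `v`, with values in the value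
  -- group of `W`, to be comparable with `W.valuation`.
  let V : ValuationSubring K := W.comap ((ι).comp C)
  have hVv : ∀ x ∈ V.toSubring, v x ≤ 1 := fun x hx => (W.valuation_le_one_iff _).2 hx
  have hDV : D ≤ V.toSubring := fun d hd => hW <| mem_krNagata.2
    ⟨fun U hU => algebraMap_mem_nagata (C_mem_coeffSubring.2 (hU hd)),
      algebraMap_mem_nagata (C_mem_coeffSubring.2 (hDA hd))⟩
  have hgauss : gauss v f ≤ gauss v g := by
    obtain ⟨f', hf', g', hg', h⟩ := mem_nagata.1 (mem_kronecker.1 hφD V (intClosure_le hDV))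
    rw [div_eq_div_iff (algebraMap_poly_ne_zero hg.ne_zero) (algebraMap_poly_ne_zero hg'.ne_zero),
      ← map_mul, ← map_mul] at h
    have h := congrArg (gauss v) (RatFunc.algebraMap_injective K h)
    rw [gauss_mul, gauss_mul, hg'.gauss_eq_one_of_le hVv, mul_one] at h
    rw [h]
    exact mul_le_of_le_one_left' (gauss_le_one_of_mem hVv hf')
  refine (W.valuation_le_one_iff _).1 ?_
  rw [map_div₀]
  exact div_le_one_of_le₀ (((valuation_algebraMap_le_gauss W.valuation hX f).trans hgauss).trans
    (gauss_le_valuation hW hg)) zero_le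

theorem exists_isUnimodular_forall_mul_mem {A : Subring K} (c : ℕ → RatFunc K)
    (hc : ∀ n, c n ∈ nagata A) (s : Finset ℕ) :
    ∃ g, IsUnimodular A g ∧ ∀ n ∈ s, ι g * c n ∈ (coeffSubring A).map ι := by
  classical
  induction s using Finset.induction_on with
  | empty => exact ⟨1, isUnimodular_of_coeff_eq_one (one_mem _) (m := 0) (by simp), by simp⟩
  | insert m s _ ih =>
    obtain ⟨g, hg, hgs⟩ := ih
    obtain ⟨f', hf', g', hg', h⟩ := mem_nagata.1 (hc m)
    refine ⟨g' * g, hg'.mul hg, Finset.forall_mem_insert _ _ _ |>.2 ⟨?_, fun n hn => ?_⟩⟩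
    · refine ⟨g * f', mul_mem hg.1 hf', ?_⟩
      have h0 := algebraMap_poly_ne_zero hg'.ne_zero
      rw [h, map_mul, map_mul]
      field_simp
    · rw [map_mul, mul_assoc]
      exact mul_mem ⟨g', hg'.1, rfl⟩ (hgs n hn)

/-- The integral closure of `A(t)` is contained in the Nagata ring of the integral closure. -/
theorem intClosure_nagata_le (A : Subring K) :
    intClosure (nagata A) ≤ nagata (intClosure A) := by
  intro φ hφ
  obtain ⟨p, hp, hpm, hpφ⟩ := mem_intClosure.1 hφ
  obtain ⟨g, hg, hgp⟩ := exists_isUnimodular_forall_mul_mem p.coeff (mem_coeffSubring.1 hp)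
    (Finset.range p.natDegree)
  have hgmem : ι g ∈ (coeffSubring A).map ι := ⟨g, hg.1, rfl⟩
  -- With `g` a common denominator of the non-leading coefficients of `p`, scaling the roots by `g`
  -- gives a monic equation for `g φ` over `A[t]`.
  have hint : ι g * φ ∈ intClosure ((coeffSubring A).map ι) := by
    refine mem_intClosure.2 ⟨p.scaleRoots (ι g), mem_coeffSubring.2 fun n => ?_,
      (monic_scaleRoots_iff _).2 hpm, ?_⟩
    · rw [coeff_scaleRoots]
      rcases lt_trichotomy n p.natDegree with h | h | h
      · obtain ⟨k, hk⟩ := Nat.exists_eq_add_of_lt h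
        have hk' : p.natDegree - n = k + 1 := by omega
        rw [hk', pow_succ', ← mul_assoc, mul_comm (p.coeff n)]
        exact mul_mem (hgp n (Finset.mem_range.2 h)) (pow_mem hgmem _)
      · rw [h, Nat.sub_self, pow_zero, mul_one, hpm.coeff_natDegree]
        exact one_mem _
      · rw [coeff_eq_zero_of_natDegree_lt h, zero_mul]
        exact zero_mem _
    · have h := scaleRoots_eval₂_mul (RingHom.id (RatFunc K)) (p := p) φ (ι g)
      simp only [RingHom.id_apply, eval₂_id] at h
      rw [h, hpφ, mul_zero]
  obtain ⟨q, hq⟩ : ∃ q : K[X], ι q = ι g * φ := by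
    obtain ⟨P, hP, hPm, hPx⟩ := mem_intClosure.1 hint
    have hlift : P ∈ Polynomial.lifts ι := by
      rw [Polynomial.lifts_iff_coeff_lifts]
      intro n
      obtain ⟨f, -, hf⟩ := mem_coeffSubring.1 hP n
      exact ⟨f, hf⟩
    obtain ⟨Q, hQ, -, hQm⟩ := Polynomial.lifts_and_natDegree_eq_and_monic hlift hPm
    refine IsIntegrallyClosed.isIntegral_iff.1 ⟨Q, hQm, ?_⟩
    rw [← eval_map, hQ, hPx]
  -- For each `V ⊇ A`, the integral element `q` lies in `V(t)`, so its coefficients lie in `V`; the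
  -- intersection of these `V` is the integral closure of `A`.
  have hqA : q ∈ coeffSubring (intClosure A) := by
    refine mem_coeffSubring.2 fun n => mem_intClosure_iff_forall.2 fun V hV => ?_
    have hle : (coeffSubring A).map ι ≤ (trivialExtension V).toSubring := by
      rintro _ ⟨f, hf, rfl⟩
      exact algebraMap_mem_nagata (coeffSubring_mono hV hf)
    have h1 : ι q / ι 1 ∈ nagata V.toSubring := by
      rw [map_one, div_one, hq]
      exact intClosure_le hle hint
    rw [div_mem_nagata_iff V q one_ne_zero, gauss_one] at h1
    exact (V.valuation_le_one_iff _).1 ((le_gauss _ q n).trans h1)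
  refine mem_nagata.2 ⟨q, hqA, g, hg.mono (le_intClosure A), ?_⟩
  rw [hq, mul_div_cancel_left₀ _ (algebraMap_poly_ne_zero hg.ne_zero)]

/-- The integral closure of `R'`. -/
theorem intClosure_krNagata {D A : Subring K} (hDA : D ≤ A) :
    intClosure (krNagata D A) = kronecker (intClosure D) ⊓ nagata (intClosure A) := by
  refine le_antisymm (le_inf (fun φ hφ => mem_kronecker.2 fun V hV => ?_)
    ((intClosure_mono inf_le_right).trans (intClosure_nagata_le A))) (kronecker_inf_nagata_le hDA)
  exact intClosure_le (krNagata_le A ((le_intClosure D).trans hV)) hφ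

end NagataIntegralClosure

end NagataKronecker

open NagataKronecker in
theorem theorem5p15 {K : Type*} [Field K] (D A : Subring K) [IsFractionRing D K]
    (hDA : D ≤ A) (hD : D = intClosure D ⊓ A)
    (hA : Finite (MaximalSpectrum A)) (hA' : Finite (MaximalSpectrum (intClosure A)))
    (s : ℕ) (hs : Nat.card (MaximalSpectrum (intClosure A)) = s)
    (hres : ∀ M : Ideal D, M.IsMaximal → ((s + 1 : ℕ) : ℕ∞) ≤ ENat.card (D ⧸ M)) :
    -- (i)
    (∀ (V : ValuationSubring K) (hV : D ≤ V.toSubring),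
      localizationAt (krNagata D A)
          (center (trivialExtension V) (krNagata D A) (krNagata_le A hV)) =
        nagata (localizationAt (A ⊓ V.toSubring)
          (center V (A ⊓ V.toSubring) inf_le_right)) ∧
      ((∀ B : Subring K, A ≤ B → V.toSubring ≤ B → B = ⊤) →
        localizationAt (krNagata D A)
            (center (trivialExtension V) (krNagata D A) (krNagata_le A hV)) =
          nagata V.toSubring)) ∧
    -- (ii)
    (∀ W : ValuationSubring (RatFunc K), krNagata D A ≤ W.toSubring →
      ∃ V : ValuationSubring K, D ≤ V.toSubring ∧ nagata (A ⊓ V.toSubring) ≤ W.toSubring) ∧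
    -- (iii)
    (∀ (M : Ideal (krNagata D A)) [M.IsMaximal],
      ∃ C : Subring K, D ≤ C ∧ localizationAt (krNagata D A) M = nagata C) ∧
    -- (iv)
    intClosure (krNagata D A) = kronecker (intClosure D) ⊓ nagata (intClosure A) := by
  subst hs
  exact ⟨fun V hV => ⟨localizationAt_center_eq hDA hA' hres V hV, fun hAV =>
      (localizationAt_center_eq hDA hA' hres V hV).trans
        (by rw [localizationAt_inf_eq hDA hA' hres V hV hAV])⟩,
    fun W hW => exists_nagata_inf_le W hW,
    fun M _ => exists_localizationAt_eq_nagata hDA hA' hres M,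
    intClosure_krNagata hDA⟩
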